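/- Let $n\in\mathbb N$, $\mathbb T^n=(\mathbb R/\mathbb Z)^n$ with normalized Haar measure $dx$, and let $|k|$ be the Euclidean length of $k\in\mathbb Z^n$. For multi-indices $\alpha,\beta\in\mathbb N_0^n$ put $\Delta_k^\alpha=\Delta_{k_1}^{\alpha_1}\cdots\Delta_{k_n}^{\alpha_n}$, where $\Delta_{k_j}f(k)=f(k+e_j)-f(k)$, and $D_x^{(\beta)}=D_{x_1}^{(\beta_1)}\cdots D_{x_n}^{(\beta_n)}$, where $D_{x_j}^{(\ell)}=\prod_{m=0}^{\ell-1}\bigl(\frac1{2\pi i}\frac{\partial}{\partial x_j}-m\bigr)$. A function $\Lambda:\mathbb Z^n\to\mathbb R$ is a weight function with parameter $\mu$ if there are constants $0<\mu_0\le\mu_1\le\mu$ and $C_0,C_1>0$ with $$C_0(1+|k|)^{\mu_0}\le\Lambda(k)\le C_1(1+|k|)^{\mu_1}\qquad(k\in\mathbb Z^n),$$ and if for all $\alpha\in\mathbb N_0^n$ and $\gamma\in\{0,1\}^n$ there is $C_{\alpha,\gamma}>0$ with $|k^\gamma\Delta_k^{\alpha+\gamma}\Lambda(k)|\le C_{\alpha,\gamma}\Lambda(k)^{1-|\alpha|/\mu}$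 for all $k\in\mathbb Z^n$. For $m\in\mathbb R$ and $0<\rho\le 1/\mu$, $S^m_{\rho,\Lambda}(\mathbb Z^n\times\mathbb T^n)$ is the set of all $\sigma:\mathbb Z^n\times\mathbb T^n\to\mathbb C$ such that $\sigma(k,\cdot)\in C^\infty(\mathbb T^n)$ for all $k$, and for all $\alpha,\beta$ there is $C_{\alpha,\beta}>0$ with $|D_x^{(\beta)}\Delta_k^\alpha\sigma(k,x)|\le C_{\alpha,\beta}\Lambda(k)^{m-\rho|\alpha|}$ for all $(k,x)$. The class $M^m_{\rho,\Lambda}(\mathbb Z^n\times\mathbb T^n)$ is the set of all $\sigma$, smooth in $x$ for every $k$, such that $k^\gamma\Delta_k^\gamma\sigma\in S^m_{\rho,\Lambda}(\mathbb Z^n\times\mathbb T^n)$ for all $\gamma\in\{0,1\}^n$. A symbol $\sigma\in M^m_{\rho,\Lambda}(\mathbb Z^n\times\mathbb T^n)$ is $M$-elliptic if there are $C,R>0$ with $|\sigma(k,x)|\ge C\Lambda(k)^m$ for all $x\in\mathbb T^n$ and all $k\in\mathbb Z^n$ with $|k|\ge R$. For $f\in\ell^2(\mathbb Z^n)$ let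 $\widehat f(x)=\sum_{k\in\mathbb Z^n}e^{-2\pi i k\cdot x}f(k)$ (convergence in $L^2(\mathbb T^n)$) and $$T_\sigma f(k)=\int_{\mathbb T^n}e^{2\pi i k\cdot x}\sigma(k,x)\widehat f(x)\,dx,\qquad k\in\mathbb Z^n.$$ **Theorem.** Let $\Lambda$ be a weight function on $\mathbb Z^n$ with parameter $\mu$, let $0<\rho\le1/\mu$, and let $\sigma\in M^0_{\rho,\Lambda}(\mathbb Z^n\times\mathbb T^n)$. Then $T_\sigma$ is a bounded linear operator $\ell^2(\mathbb Z^n)\to\ell^2(\mathbb Z^n)$, and it is Fredholm (closed range, finite-dimensional kernel, range of finite codimension) if and only if $\sigma$ is $M$-elliptic. -/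

import Mathlib

open MeasureTheory
open scoped ENNReal ContDiff

noncomputable section

/-- The Haar probability measure `dx` on the torus `𝕋ⁿ = (ℝ/ℤ)ⁿ`. -/
def torusMeasure (n : ℕ) : Measure (UnitAddTorus (Fin n)) :=
  Measure.pi fun _ => AddCircle.haarAddCircle

instance torusMeasure_isProbabilityMeasure (n : ℕ) : IsProbabilityMeasure (torusMeasure n) :=
  inferInstanceAs (IsProbabilityMeasure (Measure.pi fun _ => AddCircle.haarAddCircle))

/-- The Hilbert space `ℓ²(ℤⁿ)`. -/
abbrev EllTwo (n : ℕ) : Type := lp (fun _ : Fin n → ℤ => ℂ) 2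

/-- The Hilbert space `L²(𝕋ⁿ)`. -/
abbrev TorusLTwo (n : ℕ) : Type := Lp ℂ 2 (torusMeasure n)

/-! ### The discrete Fourier transform -/

/-- The function `x ↦ exp (2πi k·x)` as an element of `L²(𝕋ⁿ)`. -/
def torusCharacter {n : ℕ} (k : Fin n → ℤ) : TorusLTwo n :=
  ContinuousMap.toLp (E := ℂ) 2 (torusMeasure n) ℂ (UnitAddTorus.mFourier k)

theorem torusCharacter_ae {n : ℕ} (k : Fin n → ℤ) :
    ⇑(torusCharacter k) =ᵐ[torusMeasure n] UnitAddTorus.mFourier k :=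
  ContinuousMap.coeFn_toLp (torusMeasure n) (UnitAddTorus.mFourier k)

theorem torusCharacter_orthonormal (n : ℕ) :
    Orthonormal ℂ (torusCharacter : (Fin n → ℤ) → TorusLTwo n) :=
  UnitAddTorus.orthonormal_mFourier (d := Fin n)

theorem torusCharacter_span (n : ℕ) :
    (Submodule.span ℂ (Set.range
      (torusCharacter : (Fin n → ℤ) → TorusLTwo n))).topologicalClosure = ⊤ :=
  UnitAddTorus.span_mFourierLp_closure_eq_top (d := Fin n) (p := 2) (by simp)

theorem torusCharacter_range_neg (n : ℕ) :
    Set.range (fun k : Fin n → ℤ => torusCharacter (-k)) =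
      Set.range (torusCharacter : (Fin n → ℤ) → TorusLTwo n) :=
  (Equiv.neg (Fin n → ℤ)).surjective.range_comp torusCharacter

/-- The orthonormal basis of `L²(𝕋ⁿ)` given by `x ↦ exp (-2πi k·x)`, `k ∈ ℤⁿ`. -/
def dftBasis (n : ℕ) : HilbertBasis (Fin n → ℤ) ℂ (TorusLTwo n) :=
  HilbertBasis.mk (v := fun k : Fin n → ℤ => torusCharacter (-k))
    ((torusCharacter_orthonormal n).comp _ neg_injective)
    (by rw [torusCharacter_range_neg, torusCharacter_span])

theorem dftBasis_apply (n : ℕ) (k : Fin n → ℤ) : dftBasis n k = torusCharacter (-k) :=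
  congrFun (HilbertBasis.coe_mk _ _) k

/-- The discrete Fourier transform `ℓ²(ℤⁿ) → L²(𝕋ⁿ)`,
`f ↦ f̂`, `f̂(x) = ∑_k exp (-2πi k·x) f(k)` (convergence in `L²`); a unitary map. -/
def dft (n : ℕ) : EllTwo n ≃ₗᵢ[ℂ] TorusLTwo n :=
  (dftBasis n).repr.symm

theorem dft_hasSum (n : ℕ) (f : EllTwo n) :
    HasSum (fun k => f k • torusCharacter (-k)) (dft n f) := by
  have h := (dftBasis n).hasSum_repr_symm f
  simp only [dftBasis_apply] at h
  exact h

/-- Fourier inversion: `f(k) = ∫ exp (2πi k·x) f̂(x) dx`. -/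
theorem dft_inversion (n : ℕ) (f : EllTwo n) (k : Fin n → ℤ) :
    ∫ x, UnitAddTorus.mFourier k x * dft n f x ∂(torusMeasure n) = f k := by
  have h : (dftBasis n).repr (dft n f) k = f k := by simp [dft]
  rw [← h, (dftBasis n).repr_apply_apply, dftBasis_apply, MeasureTheory.L2.inner_def]
  apply integral_congr_ae
  filter_upwards [torusCharacter_ae (-k)] with x hx
  rw [hx, RCLike.inner_apply, ← UnitAddTorus.mFourier_neg, neg_neg, mul_comm]

/-! ### Differences, derivatives, symbols -/

/-- `|α| = α₁ + ⋯ + αₙ`. -/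
def multiOrder {n : ℕ} (α : Fin n → ℕ) : ℕ := ∑ j, α j

/-- The monomial `k^γ = k₁^{γ₁} ⋯ kₙ^{γₙ}`. -/
def latticeMonomial {n : ℕ} (γ : Fin n → ℕ) (k : Fin n → ℤ) : ℤ := ∏ j, k j ^ γ j

/-- The Euclidean length `|k|` of `k ∈ ℤⁿ`. -/
def latticeNorm {n : ℕ} (k : Fin n → ℤ) : ℝ := Real.sqrt (∑ j, (k j : ℝ) ^ 2)

/-- The difference operator `Δ_k^α = Δ_{k₁}^{α₁} ⋯ Δ_{kₙ}^{αₙ}`, where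
`Δ_{k_j} a (k) = a (k + e_j) - a k`. -/
def latticeDiff {n : ℕ} {G : Type*} [AddCommGroup G] (α : Fin n → ℕ)
    (a : (Fin n → ℤ) → G) : (Fin n → ℤ) → G :=
  (List.finRange n).foldr (fun j b => (fwdDiff (Pi.single j (1 : ℤ)))^[α j] b) a

/-- The partial derivative `∂f/∂x_j` of a function on the torus. -/
def torusPartial {n : ℕ} (j : Fin n) (f : UnitAddTorus (Fin n) → ℂ) :
    UnitAddTorus (Fin n) → ℂ :=
  fun x => deriv (fun t : ℝ => f (x + Pi.single j (t : UnitAddCircle))) 0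

/-- `D_{x_j}^{(ℓ)} = ∏_{m < ℓ} ((2πi)⁻¹ ∂/∂x_j - m)`. -/
def toroidalDeriv {n : ℕ} (j : Fin n) :
    ℕ → (UnitAddTorus (Fin n) → ℂ) → UnitAddTorus (Fin n) → ℂ
  | 0, f => f
  | ℓ + 1, f => fun x =>
      (2 * Real.pi * Complex.I)⁻¹ * torusPartial j (toroidalDeriv j ℓ f) x
        - (ℓ : ℂ) * toroidalDeriv j ℓ f x

/-- `D_x^{(β)} = D_{x₁}^{(β₁)} ⋯ D_{xₙ}^{(βₙ)}`. -/
def toroidalDerivMulti {n : ℕ} (β : Fin n → ℕ) (f : UnitAddTorus (Fin n) → ℂ) :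
    UnitAddTorus (Fin n) → ℂ :=
  (List.finRange n).foldr (fun j g => toroidalDeriv j (β j) g) f

/-- `f ∈ C^∞(𝕋ⁿ)`: the `ℤⁿ`-periodic lift of `f` to `ℝⁿ` is smooth. -/
def TorusSmooth {n : ℕ} (f : UnitAddTorus (Fin n) → ℂ) : Prop :=
  ContDiff ℝ ∞ (fun y : Fin n → ℝ => f (fun j => (y j : UnitAddCircle)))

/-- `Λ` is a weight function on `ℤⁿ`, with order parameter `μ`. -/
structure IsWeightFunction {n : ℕ} (Λ : (Fin n → ℤ) → ℝ) (μ : ℝ) : Prop where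
  growth : ∃ μ₀ μ₁ C₀ C₁ : ℝ, 0 < μ₀ ∧ μ₀ ≤ μ₁ ∧ μ₁ ≤ μ ∧ 0 < C₀ ∧ 0 < C₁ ∧
    ∀ k, C₀ * (1 + latticeNorm k) ^ μ₀ ≤ Λ k ∧ Λ k ≤ C₁ * (1 + latticeNorm k) ^ μ₁
  diff_bound : ∀ α γ : Fin n → ℕ, (∀ j, γ j ≤ 1) → ∃ C : ℝ, 0 < C ∧
    ∀ k, |(latticeMonomial γ k : ℝ) * latticeDiff (α + γ) Λ k|
      ≤ C * Λ k ^ (1 - (1 / μ) * (multiOrder α : ℝ))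

/-- The weighted symbol class `S^m_{ρ,Λ}(ℤⁿ × 𝕋ⁿ)`. -/
structure IsSymbolS {n : ℕ} (Λ : (Fin n → ℤ) → ℝ) (ρ m : ℝ)
    (σ : (Fin n → ℤ) → UnitAddTorus (Fin n) → ℂ) : Prop where
  smooth : ∀ k, TorusSmooth (σ k)
  bound : ∀ α β : Fin n → ℕ, ∃ C : ℝ, 0 < C ∧ ∀ k x,
    ‖toroidalDerivMulti β (latticeDiff α σ k) x‖ ≤ C * Λ k ^ (m - ρ * (multiOrder α : ℝ))

/-- The weighted symbol class `M^m_{ρ,Λ}(ℤⁿ × 𝕋ⁿ)`: `k^γ Δ_k^γ σ ∈ S^m_{ρ,Λ}` for all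
`γ ∈ {0,1}ⁿ`. -/
structure IsSymbolM {n : ℕ} (Λ : (Fin n → ℤ) → ℝ) (ρ m : ℝ)
    (σ : (Fin n → ℤ) → UnitAddTorus (Fin n) → ℂ) : Prop where
  smooth : ∀ k, TorusSmooth (σ k)
  mem : ∀ γ : Fin n → ℕ, (∀ j, γ j ≤ 1) →
    IsSymbolS Λ ρ m (fun k x => (latticeMonomial γ k : ℂ) * latticeDiff γ σ k x)

/-- `σ` (of order `m`) is `M`-elliptic: `|σ(k,x)| ≥ C Λ(k)^m` for all `x` and all `|k| ≥ R`. -/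
def IsMElliptic {n : ℕ} (Λ : (Fin n → ℤ) → ℝ) (m : ℝ)
    (σ : (Fin n → ℤ) → UnitAddTorus (Fin n) → ℂ) : Prop :=
  ∃ C R : ℝ, 0 < C ∧ 0 < R ∧ ∀ k, R ≤ latticeNorm k → ∀ x, C * Λ k ^ m ≤ ‖σ k x‖

/-- The pseudo-differential operator
`T_σ f (k) = ∫ exp (2πi k·x) σ(k,x) f̂(x) dx`. -/
def latticePDO {n : ℕ} (σ : (Fin n → ℤ) → UnitAddTorus (Fin n) → ℂ) (f : EllTwo n)
    (k : Fin n → ℤ) : ℂ :=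
  ∫ x, UnitAddTorus.mFourier k x * σ k x * dft n f x ∂(torusMeasure n)

end

open Filter Topology

/-! ### Weighted shifts on `ℓ²` of an abelian group -/

section WeightedShift

variable {G : Type*} [AddCommGroup G]

/-! Expanding `σ(k,·)` in a Fourier series turns `T_σ` into `f ↦ ∑_η a_η(k) f(k + η)`, where
`a_η(k)` is the `η`-th Fourier coefficient of `σ(k,·)`. Uniform bounds on the `x`-derivatives make
`∑ ‖a_η‖_∞` finite (`hasSummableFourier_of_boundedPartials`), so the series of weighted shifts
converges in operator norm and `T_σ` is bounded. The bound `Λ^{-ρ}` on first differences, with `Λ →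
∞`, makes `σ(k + η, x) - σ(k, x)` tend to `0` uniformly in `x` (`IsSymbolS.vanishingOscillation`).

Ellipticity implies Fredholm: modify `σ` at finitely many `k` so that it is bounded below, and let
`τ` be the reciprocal, which has the same two properties. Vanishing oscillation makes shifts commute
with `T_σ` modulo norm limits of finite rank operators. Hence `T_τ T_σ` agrees, modulo such limits,
with the operator of symbol `τσ`, and this is the identity up to finite rank
(`shiftSeries_comp_sub_one_mem_approxFiniteRank`). The roles of `σ` and `τ` can be exchanged, so
`T_σ` has a two-sided parametrix.

Fredholm implies ellipticity: otherwise there are `p_i → ∞` and `x_i` with `σ(p_i, x_i) → 0`. On a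
wave packet with envelope `ψ`, centred at `p_i` with frequency `x_i`, `T_σ` acts as multiplication
by `σ(p_i, x_i)`, up to an error governed by how far `ψ` is from being shift invariant. The packets
are weakly null, so the finite rank error of a quasi-inverse disappears in the limit, and a
sufficiently flat `ψ` gives a contradiction (`not_tendsto_zero_of_isFredholm`). -/

theorem ellTwo_summable_sq {ι : Type*} (f : lp (fun _ : ι => ℂ) 2) :
    Summable fun k => ‖f k‖ ^ 2 := by
  have h := (lp.memℓp f).summable (by norm_num)
  simpa using h

theorem ellTwo_norm_sq {ι : Type*} (f : lp (fun _ : ι => ℂ) 2) :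
    ‖f‖ ^ 2 = ∑' k, ‖f k‖ ^ 2 := by
  have h := lp.norm_rpow_eq_tsum (p := 2) (by norm_num) f
  simpa using h

theorem ellTwo_add_apply {ι : Type*} (f g : lp (fun _ : ι => ℂ) 2) (k : ι) :
    (f + g) k = f k + g k := rfl

theorem ellTwo_sub_apply {ι : Type*} (f g : lp (fun _ : ι => ℂ) 2) (k : ι) :
    (f - g) k = f k - g k := rfl

theorem ellTwo_smul_apply {ι : Type*} (c : ℂ) (f : lp (fun _ : ι => ℂ) 2) (k : ι) :
    (c • f) k = c * f k := rfl

theorem memℓp_two_of_summable {ι : Type*} {f : ι → ℂ} (h : Summable fun k => ‖f k‖ ^ 2) :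
    Memℓp f 2 :=
  memℓp_gen (by simpa using h)

theorem summable_sq_weightedShift (a : lp (fun _ : G => ℂ) ∞) (η : G)
    (f : lp (fun _ : G => ℂ) 2) :
    Summable (fun k => ‖a k * f (k + η)‖ ^ 2) ∧
      ∑' k, ‖a k * f (k + η)‖ ^ 2 ≤ (‖a‖ * ‖f‖) ^ 2 := by
  have h : ∀ k, ‖a k * f (k + η)‖ ^ 2 ≤ ‖a‖ ^ 2 * ‖f (k + η)‖ ^ 2 := fun k => by
    rw [norm_mul, mul_pow]
    have := lp.norm_apply_le_norm (p := ∞) (by simp) a k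
    gcongr
  have hs := ((Equiv.addRight η).summable_iff.mpr (ellTwo_summable_sq f)).mul_left (‖a‖ ^ 2)
  have hs' := Summable.of_nonneg_of_le (fun _ => by positivity) h hs
  refine ⟨hs', ?_⟩
  rw [mul_pow, ellTwo_norm_sq f, ← (Equiv.addRight η).tsum_eq (fun k => ‖f k‖ ^ 2),
    ← tsum_mul_left]
  exact hs'.tsum_le_tsum h hs

/-- The linear map `f ↦ (k ↦ a k * f (k + η))`. -/
noncomputable def weightedShiftLinear (a : lp (fun _ : G => ℂ) ∞) (η : G) :
    lp (fun _ : G => ℂ) 2 →ₗ[ℂ] lp (fun _ : G => ℂ) 2 where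
  toFun f := ⟨fun k => a k * f (k + η),
    memℓp_two_of_summable (summable_sq_weightedShift a η f).1⟩
  map_add' f g := by
    ext k
    exact mul_add _ _ _
  map_smul' c f := by
    ext k
    exact mul_left_comm _ _ _

theorem norm_weightedShiftLinear_le (a : lp (fun _ : G => ℂ) ∞) (η : G)
    (f : lp (fun _ : G => ℂ) 2) : ‖weightedShiftLinear a η f‖ ≤ ‖a‖ * ‖f‖ := by
  refine le_of_sq_le_sq ?_ (by positivity)
  rw [ellTwo_norm_sq]
  exact (summable_sq_weightedShift a η f).2

/-- The bounded operator `f ↦ (k ↦ a k * f (k + η))`. -/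
noncomputable def weightedShift (a : lp (fun _ : G => ℂ) ∞) (η : G) :
    lp (fun _ : G => ℂ) 2 →L[ℂ] lp (fun _ : G => ℂ) 2 :=
  (weightedShiftLinear a η).mkContinuous ‖a‖ (norm_weightedShiftLinear_le a η)

@[simp]
theorem weightedShift_apply (a : lp (fun _ : G => ℂ) ∞) (η : G) (f : lp (fun _ : G => ℂ) 2)
    (k : G) : weightedShift a η f k = a k * f (k + η) := rfl

theorem norm_weightedShift_le (a : lp (fun _ : G => ℂ) ∞) (η : G) : ‖weightedShift a η‖ ≤ ‖a‖ :=
  LinearMap.mkContinuous_norm_le _ (norm_nonneg a) (norm_weightedShiftLinear_le a η)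

theorem weightedShift_sub (a b : lp (fun _ : G => ℂ) ∞) (η : G) :
    weightedShift (a - b) η = weightedShift a η - weightedShift b η := by
  ext f k
  simp [sub_mul]

/-- The translate `k ↦ a (k + η)` of a bounded function. -/
noncomputable def boundedShift (η : G) (a : lp (fun _ : G => ℂ) ∞) : lp (fun _ : G => ℂ) ∞ :=
  ⟨fun k => a (k + η), memℓp_infty ⟨‖a‖, by
    rintro _ ⟨k, rfl⟩
    exact lp.norm_apply_le_norm (by simp) a _⟩⟩

@[simp]
theorem boundedShift_apply (η : G) (a : lp (fun _ : G => ℂ) ∞) (k : G) :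
    boundedShift η a k = a (k + η) := rfl

/-- Together with `weightedShift_comp_shift` this shows that the commutator of a shift and a
weighted shift is again a weighted shift, with coefficient the increment of `a` along `η`. -/
theorem shift_comp_weightedShift (a : lp (fun _ : G => ℂ) ∞) (η ζ : G) :
    weightedShift 1 η ∘L weightedShift a ζ = weightedShift (boundedShift η a) (η + ζ) := by
  ext f k
  simp [add_assoc, lp.infty_coeFn_one]

theorem weightedShift_comp_shift (a : lp (fun _ : G => ℂ) ∞) (η ζ : G) :
    weightedShift a ζ ∘L weightedShift 1 η = weightedShift a (η + ζ) := by
  ext f k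
  simp [lp.infty_coeFn_one, add_assoc, add_comm ζ η]

theorem weightedShift_zero_comp_shift (a : lp (fun _ : G => ℂ) ∞) (η : G) :
    weightedShift a 0 ∘L weightedShift 1 η = weightedShift a η := by
  rw [weightedShift_comp_shift, add_zero]

end WeightedShift

/-! ### Limits of finite rank operators -/

section FiniteRank

variable {E : Type*} [NormedAddCommGroup E] [NormedSpace ℂ E]

/-- The operators of finite rank. -/
noncomputable def finiteRankOperators (E : Type*) [NormedAddCommGroup E] [NormedSpace ℂ E] :
    Submodule ℂ (E →L[ℂ] E) :=
  (LinearMap.finiteRange ℂ E E).comap (ContinuousLinearMap.coeLM ℂ)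

theorem mem_finiteRankOperators {T : E →L[ℂ] E} :
    T ∈ finiteRankOperators E ↔ (T : E →ₗ[ℂ] E).HasFiniteRange :=
  LinearMap.mem_finiteRange_iff_hasFiniteRange

theorem mem_finiteRankOperators_of_range_le {T : E →L[ℂ] E} {V : Submodule ℂ E}
    [FiniteDimensional ℂ V] (h : ∀ f, T f ∈ V) : T ∈ finiteRankOperators E := by
  rw [mem_finiteRankOperators]
  have : FiniteDimensional ℂ (T : E →ₗ[ℂ] E).range :=
    Submodule.finiteDimensional_of_le (S₂ := V) (by rintro _ ⟨x, rfl⟩; exact h x)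
  exact (Submodule.fg_iff_finiteDimensional _).mpr this

theorem comp_mem_finiteRankOperators_left (A : E →L[ℂ] E) {T : E →L[ℂ] E}
    (hT : T ∈ finiteRankOperators E) : A ∘L T ∈ finiteRankOperators E :=
  mem_finiteRankOperators.mpr ((mem_finiteRankOperators.mp hT).comp_left (A : E →ₗ[ℂ] E))

theorem comp_mem_finiteRankOperators_right (A : E →L[ℂ] E) {T : E →L[ℂ] E}
    (hT : T ∈ finiteRankOperators E) : T ∘L A ∈ finiteRankOperators E :=
  mem_finiteRankOperators.mpr ((mem_finiteRankOperators.mp hT).comp_right (A : E →ₗ[ℂ] E))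

/-- The norm limits of operators of finite rank. -/
noncomputable def approxFiniteRank (E : Type*) [NormedAddCommGroup E] [NormedSpace ℂ E] :
    Submodule ℂ (E →L[ℂ] E) :=
  (finiteRankOperators E).topologicalClosure

theorem isClosed_approxFiniteRank : IsClosed (approxFiniteRank E : Set (E →L[ℂ] E)) :=
  Submodule.isClosed_topologicalClosure _

theorem finiteRankOperators_le_approxFiniteRank : finiteRankOperators E ≤ approxFiniteRank E :=
  Submodule.le_topologicalClosure _

theorem comp_mem_approxFiniteRank_left (A : E →L[ℂ] E) {T : E →L[ℂ] E}
    (hT : T ∈ approxFiniteRank E) : A ∘L T ∈ approxFiniteRank E :=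
  map_mem_closure (f := fun T => A ∘L T) (by fun_prop) hT
    fun _ h => comp_mem_finiteRankOperators_left A h

theorem hasSum_mem_approxFiniteRank {ι : Type*} {S : ι → E →L[ℂ] E} {T : E →L[ℂ] E}
    (hS : ∀ i, S i ∈ approxFiniteRank E) (h : HasSum S T) : T ∈ approxFiniteRank E :=
  isClosed_approxFiniteRank.mem_of_tendsto h
    (Eventually.of_forall fun _ => Submodule.sum_mem _ fun i _ => hS i)

variable [CompleteSpace E]

/-- Choose `F` of finite rank within distance `1` of `T - 1`. Then `T - F` is invertible by the
Neumann series, and its inverse inverts `T` on either side up to finite rank. -/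
theorem exists_comp_sub_mem_finiteRank {T : E →L[ℂ] E} (h : T - 1 ∈ approxFiniteRank E) :
    ∃ A B : E →L[ℂ] E, A ∘L T - 1 ∈ finiteRankOperators E ∧
      T ∘L B - 1 ∈ finiteRankOperators E := by
  obtain ⟨F, hF, hTF⟩ := Metric.mem_closure_iff.mp h 1 one_pos
  rw [dist_eq_norm] at hTF
  have hu : IsUnit (1 + (T - 1 - F)) := by
    have := (Units.oneSub (-(T - 1 - F)) (by rwa [norm_neg])).isUnit
    have e : (1 : E →L[ℂ] E) - -(T - 1 - F) = 1 + (T - 1 - F) := sub_neg_eq_add _ _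
    rw [← e]
    exact this
  obtain ⟨u, hu⟩ := hu
  have hT : T = u + F := by rw [hu]; abel
  refine ⟨↑u⁻¹, ↑u⁻¹, ?_, ?_⟩
  · have : (↑u⁻¹ : E →L[ℂ] E) ∘L T - 1 = (↑u⁻¹ : E →L[ℂ] E) ∘L F := by
      change (↑u⁻¹ : E →L[ℂ] E) * T - 1 = (↑u⁻¹ : E →L[ℂ] E) * F
      rw [hT, mul_add, Units.inv_mul]; abel
    rw [this]
    exact comp_mem_finiteRankOperators_left _ hF
  · have : T ∘L (↑u⁻¹ : E →L[ℂ] E) - 1 = F ∘L (↑u⁻¹ : E →L[ℂ] E) := by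
      change T * (↑u⁻¹ : E →L[ℂ] E) - 1 = F * (↑u⁻¹ : E →L[ℂ] E)
      rw [hT, add_mul, Units.mul_inv]; abel
    rw [this]
    exact comp_mem_finiteRankOperators_right _ hF

/-- An operator that is invertible modulo limits of operators of finite rank is Fredholm. -/
theorem isFredholm_of_comp_sub_mem {T L R : E →L[ℂ] E} (hL : L ∘L T - 1 ∈ approxFiniteRank E)
    (hR : T ∘L R - 1 ∈ approxFiniteRank E) : T.IsFredholm := by
  obtain ⟨A, -, hA, -⟩ := exists_comp_sub_mem_finiteRank hL
  obtain ⟨-, B, -, hB⟩ := exists_comp_sub_mem_finiteRank hR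
  open LinearMap.FiniteRangeSetoid in
  have hl : (A ∘L L).toLinearMap ∘ₗ T.toLinearMap ≈ LinearMap.id :=
    equiv_iff_hasFiniteRange.mpr (mem_finiteRankOperators.mp hA)
  have hr : T.toLinearMap ∘ₗ (R ∘L B).toLinearMap ≈ LinearMap.id :=
    equiv_iff_hasFiniteRange.mpr (mem_finiteRankOperators.mp hB)
  refine .of_isQuasiInverse (v := A ∘L L) ⟨hl, ?_⟩
  -- Left and right inverses modulo finite rank coincide modulo finite rank, by the usual
  -- associativity argument, so the left one is two-sided.
  have h : (A ∘L L).toLinearMap ≈ (R ∘L B).toLinearMap := calc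
    _ = (A ∘L L).toLinearMap ∘ₗ LinearMap.id := (LinearMap.comp_id _).symm
    _ ≈ (A ∘L L).toLinearMap ∘ₗ (T.toLinearMap ∘ₗ (R ∘L B).toLinearMap) :=
      equiv_comp_left (Setoid.symm hr)
    _ = ((A ∘L L).toLinearMap ∘ₗ T.toLinearMap) ∘ₗ (R ∘L B).toLinearMap := rfl
    _ ≈ LinearMap.id ∘ₗ (R ∘L B).toLinearMap := equiv_comp_right hl
    _ = (R ∘L B).toLinearMap := LinearMap.id_comp _
  exact Setoid.trans (equiv_comp_left h) hr

end FiniteRank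

/-! ### Decaying weights -/

section Decay

variable {G : Type*} [AddCommGroup G]

theorem mem_finiteRankOperators_of_apply_eq_zero {ι : Type*}
    {T : lp (fun _ : ι => ℂ) 2 →L[ℂ] lp (fun _ : ι => ℂ) 2} (s : Finset ι)
    (hT : ∀ f, ∀ k ∉ s, T f k = 0) : T ∈ finiteRankOperators (lp (fun _ : ι => ℂ) 2) := by
  classical
  let V : Submodule ℂ (lp (fun _ : ι => ℂ) 2) :=
    Submodule.span ℂ ((s.image fun k => lp.single 2 k (1 : ℂ) : Finset _) : Set _)
  have : FiniteDimensional ℂ V := FiniteDimensional.span_finset ℂ _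
  refine mem_finiteRankOperators_of_range_le (V := V) fun f => ?_
  have h : T f = ∑ k ∈ s, T f k • lp.single 2 k (1 : ℂ) := by
    ext l
    rw [lp.coeFn_sum, Finset.sum_apply]
    by_cases hl : l ∈ s
    · rw [Finset.sum_eq_single l]
      · simp
      · intro k _ hk
        simp [hk.symm]
      · exact fun h => absurd hl h
    · rw [hT f l hl, Finset.sum_eq_zero]
      intro k hk
      have : l ≠ k := by rintro rfl; exact hl hk
      simp [this]
  rw [h]
  exact Submodule.sum_mem _ fun k hk => Submodule.smul_mem _ _
    (Submodule.subset_span (by simpa using ⟨k, hk, rfl⟩))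

/-- Setting the coefficients of modulus below `ε / 2` to zero leaves finitely many, hence a finite
rank operator, and costs at most `ε / 2` in norm. -/
theorem weightedShift_mem_approxFiniteRank {a : lp (fun _ : G => ℂ) ∞}
    (ha : Tendsto (fun k => a k) cofinite (𝓝 0)) (η : G) :
    weightedShift a η ∈ approxFiniteRank (lp (fun _ : G => ℂ) 2) := by
  classical
  refine Metric.mem_closure_iff.mpr fun ε hε => ?_
  have hfin : {k | ¬ ‖a k‖ < ε / 2}.Finite := by
    have := (Metric.tendsto_nhds.mp ha) (ε / 2) (half_pos hε)
    simpa [dist_eq_norm] using this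
  let b : lp (fun _ : G => ℂ) ∞ := ⟨fun k => if ‖a k‖ < ε / 2 then 0 else a k,
    memℓp_infty ⟨‖a‖, by
      rintro _ ⟨k, rfl⟩
      dsimp only
      split_ifs
      · simp
      · exact lp.norm_apply_le_norm (by simp) a _⟩⟩
  refine ⟨weightedShift b η, mem_finiteRankOperators_of_apply_eq_zero hfin.toFinset ?_, ?_⟩
  · intro f k hk
    have : ‖a k‖ < ε / 2 := by simpa using hk
    rw [weightedShift_apply, show b k = 0 from if_pos this, zero_mul]
  · rw [dist_eq_norm, ← weightedShift_sub]
    refine (norm_weightedShift_le _ _).trans_lt (lt_of_le_of_lt ?_ (half_lt_self hε))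
    refine lp.norm_le_of_forall_le (half_pos hε).le fun k => ?_
    change ‖a k - if ‖a k‖ < ε / 2 then 0 else a k‖ ≤ ε / 2
    split_ifs with h
    · simpa using h.le
    · simpa using (half_pos hε).le

end Decay

/-! ### Series of weighted shifts -/

section ShiftSeries

variable {G : Type*} [AddCommGroup G]

/-- The operator `f ↦ (k ↦ ∑_η a_η(k) f(k + η))`. -/
noncomputable def shiftSeries (a : G → lp (fun _ : G => ℂ) ∞) :
    lp (fun _ : G => ℂ) 2 →L[ℂ] lp (fun _ : G => ℂ) 2 :=
  ∑' η, weightedShift (a η) η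

variable {a b : G → lp (fun _ : G => ℂ) ∞}

theorem hasSum_shiftSeries (ha : Summable fun η => ‖a η‖) :
    HasSum (fun η => weightedShift (a η) η) (shiftSeries a) :=
  (Summable.of_norm_bounded ha fun η => norm_weightedShift_le (a η) η).hasSum

theorem hasSum_apply_of_hasSum {ι κ : Type*}
    {S : ι → lp (fun _ : κ => ℂ) 2 →L[ℂ] lp (fun _ : κ => ℂ) 2}
    {T : lp (fun _ : κ => ℂ) 2 →L[ℂ] lp (fun _ : κ => ℂ) 2} (h : HasSum S T)
    (f : lp (fun _ : κ => ℂ) 2) (k : κ) : HasSum (fun i => S i f k) (T f k) :=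
  h.mapL ((lp.evalCLM ℂ (fun _ : κ => ℂ) 2 k) ∘L ContinuousLinearMap.apply ℂ _ f)

theorem hasSum_shiftSeries_apply (ha : Summable fun η => ‖a η‖) (f : lp (fun _ : G => ℂ) 2)
    (k : G) : HasSum (fun η => a η k * f (k + η)) (shiftSeries a f k) :=
  hasSum_apply_of_hasSum (hasSum_shiftSeries ha) f k

theorem shift_commutator_mem_approxFiniteRank (ha : Summable fun η => ‖a η‖) (η : G)
    (hosc : ∀ ζ, Tendsto (fun k => a ζ (k + η) - a ζ k) cofinite (𝓝 0)) :
    weightedShift 1 η ∘L shiftSeries a - shiftSeries a ∘L weightedShift 1 η ∈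
      approxFiniteRank (lp (fun _ : G => ℂ) 2) := by
  have h1 := (hasSum_shiftSeries ha).mapL
    (ContinuousLinearMap.compL ℂ _ _ _ (weightedShift (G := G) 1 η))
  have h2 := (hasSum_shiftSeries ha).mapL
    ((ContinuousLinearMap.compL ℂ _ _ _).flip (weightedShift (G := G) 1 η))
  refine hasSum_mem_approxFiniteRank (fun ζ => ?_) (h1.sub h2)
  simp only [ContinuousLinearMap.compL_apply, ContinuousLinearMap.flip_apply]
  rw [shift_comp_weightedShift, weightedShift_comp_shift, ← weightedShift_sub]
  exact weightedShift_mem_approxFiniteRank (hosc ζ) _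

theorem norm_weightedShift_one_le (η : G) : ‖weightedShift (1 : lp (fun _ : G => ℂ) ∞) η‖ ≤ 1 :=
  (norm_weightedShift_le _ _).trans (norm_one (α := lp (fun _ : G => ℂ) ∞)).le

/-- In `∑_η b_η S_η A`, with `S_η` the shift by `η`, each `S_η` is moved to the right of `A`. The
result `D = ∑_η b_η A S_η` evaluates both symbols at the same point `k`, and `hab` says that it
reproduces `f(k)` off a finite set. -/
theorem shiftSeries_comp_sub_one_mem_approxFiniteRank (ha : Summable fun η => ‖a η‖)
    (hb : Summable fun η => ‖b η‖)
    (hosc : ∀ η ζ, Tendsto (fun k => a ζ (k + η) - a ζ k) cofinite (𝓝 0))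
    (hab : ∀ᶠ k in cofinite, ∀ f : lp (fun _ : G => ℂ) 2,
      HasSum (fun η => b η k * shiftSeries a (weightedShift 1 η f) k) (f k)) :
    shiftSeries b ∘L shiftSeries a - 1 ∈ approxFiniteRank (lp (fun _ : G => ℂ) 2) := by
  set A := shiftSeries a
  have hD : Summable fun η => weightedShift (b η) 0 ∘L (A ∘L weightedShift 1 η) := by
    refine Summable.of_norm_bounded (hb.mul_right ‖A‖) fun η => ?_
    refine (ContinuousLinearMap.opNorm_comp_le _ _).trans ?_
    refine mul_le_mul (norm_weightedShift_le _ _) ?_ (norm_nonneg _) (norm_nonneg _)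
    refine (ContinuousLinearMap.opNorm_comp_le _ _).trans ?_
    exact mul_le_of_le_one_right (norm_nonneg _) (norm_weightedShift_one_le η)
  obtain ⟨D, hD⟩ := hD
  have hBA : HasSum (fun η => weightedShift (b η) 0 ∘L (weightedShift 1 η ∘L A))
      (shiftSeries b ∘L A) := by
    have := (hasSum_shiftSeries hb).mapL ((ContinuousLinearMap.compL ℂ _ _ _).flip A)
    refine this.congr_fun fun η => ?_
    rw [← ContinuousLinearMap.comp_assoc, weightedShift_zero_comp_shift]
    rfl
  have h1 : shiftSeries b ∘L A - D ∈ approxFiniteRank (lp (fun _ : G => ℂ) 2) := by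
    refine hasSum_mem_approxFiniteRank (fun η => ?_) (hBA.sub hD)
    rw [← ContinuousLinearMap.comp_sub]
    exact comp_mem_approxFiniteRank_left _
      (shift_commutator_mem_approxFiniteRank ha η (hosc η))
  have h2 : D - 1 ∈ approxFiniteRank (lp (fun _ : G => ℂ) 2) := by
    refine finiteRankOperators_le_approxFiniteRank
      (mem_finiteRankOperators_of_apply_eq_zero (eventually_cofinite.mp hab).toFinset
        fun f k hk => ?_)
    rw [Set.Finite.mem_toFinset, Set.mem_ofPred_eq, not_not] at hk
    have h3 := hasSum_apply_of_hasSum hD f k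
    have h4 : HasSum (fun η => b η k * shiftSeries a (weightedShift 1 η f) k) (D f k) := by
      refine h3.congr_fun fun η => ?_
      simp [A]
    have := h4.unique (hk f)
    change D f k - f k = 0
    rw [this, sub_self]
  have := Submodule.add_mem _ h1 h2
  rwa [sub_add_sub_cancel] at this

end ShiftSeries

/-! ### Fourier series of symbols -/

section FourierSeries

variable {n : ℕ}

theorem mFourierCoeff_eq_integral_torusMeasure (f : UnitAddTorus (Fin n) → ℂ) (η : Fin n → ℤ) :
    UnitAddTorus.mFourierCoeff f η =
      ∫ x, UnitAddTorus.mFourier (-η) x * f x ∂(torusMeasure n) := rfl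

theorem norm_mFourier_apply (η : Fin n → ℤ) (x : UnitAddTorus (Fin n)) :
    ‖UnitAddTorus.mFourier η x‖ = 1 := by
  rw [UnitAddTorus.mFourier, ContinuousMap.coe_mk, norm_prod]
  exact Finset.prod_eq_one fun _ _ => Circle.norm_coe _

theorem norm_mFourierCoeff_le {f : UnitAddTorus (Fin n) → ℂ} {C : ℝ} (hf : ∀ x, ‖f x‖ ≤ C)
    (η : Fin n → ℤ) : ‖UnitAddTorus.mFourierCoeff f η‖ ≤ C := by
  rw [mFourierCoeff_eq_integral_torusMeasure]
  refine (norm_integral_le_of_norm_le_const (C := C) (Eventually.of_forall fun x => ?_)).trans ?_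
  · rw [norm_mul, norm_mFourier_apply, one_mul]
    exact hf x
  · simp

theorem integrable_torus_mul {f : UnitAddTorus (Fin n) → ℂ} (hf : Continuous f)
    {g : UnitAddTorus (Fin n) → ℂ} (hg : Integrable g (torusMeasure n)) :
    Integrable (fun x => f x * g x) (torusMeasure n) := by
  obtain ⟨C, hC⟩ := (isCompact_range hf).isBounded.exists_norm_le
  exact hg.bdd_mul hf.aestronglyMeasurable (Eventually.of_forall fun x => hC _ ⟨x, rfl⟩)

/-- The Fourier series of `τ` converges absolutely and pointwise to `τ`, so it may be integrated
term by term against `g`. -/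
theorem hasSum_mFourierCoeff_mul_integral {τ : UnitAddTorus (Fin n) → ℂ} (hτ : Continuous τ)
    (hs : Summable (UnitAddTorus.mFourierCoeff τ)) {g : UnitAddTorus (Fin n) → ℂ}
    (hg : Integrable g (torusMeasure n)) :
    HasSum (fun η => UnitAddTorus.mFourierCoeff τ η *
        ∫ x, UnitAddTorus.mFourier η x * g x ∂(torusMeasure n))
      (∫ x, τ x * g x ∂(torusMeasure n)) := by
  have h := hasSum_integral_of_summable_integral_norm (μ := torusMeasure n)
    (F := fun η x => UnitAddTorus.mFourierCoeff τ η * (UnitAddTorus.mFourier η x * g x))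
    (fun η => (integrable_torus_mul (UnitAddTorus.mFourier η).continuous hg).const_mul _)
    (by
      simp only [norm_mul, norm_mFourier_apply, one_mul, integral_const_mul]
      exact hs.norm.mul_right _)
  simp only [integral_const_mul] at h
  have e : ∫ x, τ x * g x ∂(torusMeasure n) = ∫ x, ∑' η, UnitAddTorus.mFourierCoeff τ η *
      (UnitAddTorus.mFourier η x * g x) ∂(torusMeasure n) := by
    refine integral_congr_ae (Eventually.of_forall fun x => ?_)
    have hx := (UnitAddTorus.hasSum_mFourier_series_apply_of_summable
      (f := ⟨τ, hτ⟩) hs x).mul_right (g x)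
    simp only [smul_eq_mul, mul_assoc] at hx
    exact hx.tsum_eq.symm
  rw [e]
  exact h

/-- Symbols that are continuous in `x` and whose Fourier coefficients are dominated, uniformly
in `k`, by a summable sequence. -/
structure HasSummableFourier (σ : (Fin n → ℤ) → UnitAddTorus (Fin n) → ℂ) : Prop where
  continuous : ∀ k, Continuous (σ k)
  bound : ∃ B : (Fin n → ℤ) → ℝ, Summable B ∧
    ∀ k η, ‖UnitAddTorus.mFourierCoeff (σ k) η‖ ≤ B η

namespace HasSummableFourier

variable {σ τ : (Fin n → ℤ) → UnitAddTorus (Fin n) → ℂ}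

theorem summable (h : HasSummableFourier σ) (k : Fin n → ℤ) :
    Summable (UnitAddTorus.mFourierCoeff (σ k)) := by
  obtain ⟨B, hB, h⟩ := h.bound
  exact .of_norm_bounded hB (h k)

/-- The coefficient `k ↦ σ^(k, η)`. -/
noncomputable def coeff (h : HasSummableFourier σ) (η : Fin n → ℤ) :
    lp (fun _ : Fin n → ℤ => ℂ) ∞ :=
  ⟨fun k => UnitAddTorus.mFourierCoeff (σ k) η, memℓp_infty (by
    obtain ⟨B, -, h⟩ := h.bound
    exact ⟨B η, by rintro _ ⟨k, rfl⟩; exact h k η⟩)⟩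

theorem coeff_apply (h : HasSummableFourier σ) (η k : Fin n → ℤ) :
    h.coeff η k = UnitAddTorus.mFourierCoeff (σ k) η := rfl

theorem summable_norm_coeff (h : HasSummableFourier σ) : Summable fun η => ‖h.coeff η‖ := by
  obtain ⟨B, hB, hb⟩ := h.bound
  exact .of_nonneg_of_le (fun _ => norm_nonneg _) (fun η => lp.norm_le_of_forall_le
    ((norm_nonneg _).trans (hb 0 η)) fun k => hb k η) hB

theorem integrable_dft (f : EllTwo n) : Integrable (dft n f) (torusMeasure n) :=
  (Lp.memLp (dft n f)).integrable (by norm_num)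

theorem integral_mul_mFourier_dft (f : EllTwo n) (k η : Fin n → ℤ) :
    ∫ x, UnitAddTorus.mFourier η x * (UnitAddTorus.mFourier k x * dft n f x) ∂(torusMeasure n) =
      f (k + η) := by
  rw [← dft_inversion n f (k + η)]
  simp only [UnitAddTorus.mFourier_add]
  congr with x
  ring

/-- The case `η = 0` identifies the series with the pseudo-differential operator; general `η` is
what the composition formula needs. -/
theorem shiftSeries_apply_eq (h : HasSummableFourier σ) (f : EllTwo n) (k η : Fin n → ℤ) :
    shiftSeries h.coeff (weightedShift 1 η f) k =
      ∫ x, σ k x * (UnitAddTorus.mFourier (k + η) x * dft n f x) ∂(torusMeasure n) := by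
  have h1 := hasSum_shiftSeries_apply h.summable_norm_coeff (weightedShift 1 η f) k
  have h2 := hasSum_mFourierCoeff_mul_integral (h.continuous k) (h.summable k)
    (integrable_torus_mul (UnitAddTorus.mFourier (k + η)).continuous (integrable_dft f))
  refine h1.unique (h2.congr_fun fun ζ => ?_)
  rw [integral_mul_mFourier_dft, coeff_apply, weightedShift_apply, lp.infty_coeFn_one,
    Pi.one_apply, one_mul, add_right_comm]

theorem shiftSeries_apply_eq_latticePDO (h : HasSummableFourier σ) (f : EllTwo n)
    (k : Fin n → ℤ) : shiftSeries h.coeff f k = latticePDO σ f k := by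
  have h1 := h.shiftSeries_apply_eq f k 0
  have h0 : weightedShift (G := Fin n → ℤ) 1 0 f = f := by
    ext l
    simp [lp.infty_coeFn_one]
  rw [h0, add_zero] at h1
  rw [h1, latticePDO]
  congr with x
  ring

/-- With `k` frozen, summing over `η` rebuilds `τ(k,·)` under the integral; since `τσ = 1` there,
Fourier inversion remains. -/
theorem hasSum_coeff_mul_shiftSeries (hσ : HasSummableFourier σ) (hτ : HasSummableFourier τ)
    {k : Fin n → ℤ} (hk : ∀ x, τ k x * σ k x = 1) (f : EllTwo n) :
    HasSum (fun η => hτ.coeff η k * shiftSeries hσ.coeff (weightedShift 1 η f) k) (f k) := by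
  have h := hasSum_mFourierCoeff_mul_integral (hτ.continuous k) (hτ.summable k)
    (integrable_torus_mul (hσ.continuous k)
      (integrable_torus_mul (UnitAddTorus.mFourier k).continuous (integrable_dft f)))
  rw [← dft_inversion n f k]
  convert h using 1
  · ext η
    rw [coeff_apply, shiftSeries_apply_eq]
    congr 2 with x
    rw [UnitAddTorus.mFourier_add]
    ring
  · congr with x
    rw [← mul_assoc, hk, one_mul]

theorem tendsto_coeff_sub (hσ : HasSummableFourier σ) {η : Fin n → ℤ}
    (hosc : ∀ ε > 0, ∀ᶠ k in cofinite, ∀ x, ‖σ (k + η) x - σ k x‖ ≤ ε) (ζ : Fin n → ℤ) :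
    Tendsto (fun k => hσ.coeff ζ (k + η) - hσ.coeff ζ k) cofinite (𝓝 0) := by
  rw [Metric.tendsto_nhds]
  intro ε hε
  filter_upwards [hosc (ε / 2) (half_pos hε)] with k hk
  rw [dist_zero_right, coeff_apply, coeff_apply]
  refine lt_of_le_of_lt ?_ (half_lt_self hε)
  have h := norm_mFourierCoeff_le hk ζ
  have hint (l : Fin n → ℤ) : Integrable
      (fun x => UnitAddTorus.mFourier (-ζ) x * σ l x) (torusMeasure n) :=
    ((UnitAddTorus.mFourier (-ζ)).continuous.mul (hσ.continuous l)).integrable_of_hasCompactSupport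
      (HasCompactSupport.of_compactSpace _)
  have e : UnitAddTorus.mFourierCoeff (fun x => σ (k + η) x - σ k x) ζ =
      UnitAddTorus.mFourierCoeff (σ (k + η)) ζ - UnitAddTorus.mFourierCoeff (σ k) ζ := by
    simp only [mFourierCoeff_eq_integral_torusMeasure, mul_sub]
    exact integral_sub (hint _) (hint _)
  rwa [e] at h

end HasSummableFourier

/-- The symbol `σ` has vanishing oscillation at infinity. -/
def VanishingOscillation (σ : (Fin n → ℤ) → UnitAddTorus (Fin n) → ℂ) : Prop :=
  ∀ η : Fin n → ℤ, ∀ ε > 0, ∀ᶠ k in cofinite, ∀ x, ‖σ (k + η) x - σ k x‖ ≤ ε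

theorem isFredholm_of_mul_eq_one {σ τ : (Fin n → ℤ) → UnitAddTorus (Fin n) → ℂ}
    (hσ : HasSummableFourier σ) (hτ : HasSummableFourier τ) (hσo : VanishingOscillation σ)
    (hτo : VanishingOscillation τ) (h : ∀ᶠ k in cofinite, ∀ x, τ k x * σ k x = 1) :
    (shiftSeries hσ.coeff).IsFredholm := by
  refine isFredholm_of_comp_sub_mem (L := shiftSeries hτ.coeff) (R := shiftSeries hτ.coeff) ?_ ?_
  · refine shiftSeries_comp_sub_one_mem_approxFiniteRank hσ.summable_norm_coeff
      hτ.summable_norm_coeff (fun η => hσ.tendsto_coeff_sub (hσo η)) ?_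
    filter_upwards [h] with k hk f
    exact hσ.hasSum_coeff_mul_shiftSeries hτ hk f
  · refine shiftSeries_comp_sub_one_mem_approxFiniteRank hτ.summable_norm_coeff
      hσ.summable_norm_coeff (fun η => hτ.tendsto_coeff_sub (hτo η)) ?_
    filter_upwards [h] with k hk f
    exact hτ.hasSum_coeff_mul_shiftSeries hσ (fun x => by rw [mul_comm, hk]) f

end FourierSeries

/-! ### Weakly null sequences -/

section WeaklyNull

/-- For bounded sequences, coordinatewise convergence suffices because finitely supported vectors
are dense. -/
theorem tendsto_inner_of_tendsto_apply {ι : Type*} {u : ℕ → lp (fun _ : ι => ℂ) 2} {C : ℝ}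
    (hC : ∀ i, ‖u i‖ ≤ C) (hu : ∀ k, Tendsto (fun i => u i k) atTop (𝓝 0))
    (g : lp (fun _ : ι => ℂ) 2) : Tendsto (fun i => inner ℂ g (u i)) atTop (𝓝 0) := by
  classical
  have hC0 : 0 ≤ C := (norm_nonneg _).trans (hC 0)
  rw [Metric.tendsto_nhds]
  intro ε hε
  -- `C + 1` rather than `C`, since `C` may vanish.
  have hδ : 0 < ε / 2 / (C + 1) := by positivity
  obtain ⟨s, hs⟩ := ((lp.hasSum_single (by norm_num) g).eventually
    (Metric.ball_mem_nhds g hδ)).exists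
  set h := ∑ k ∈ s, lp.single 2 k (g k) with hh
  have h1 : Tendsto (fun i => inner ℂ h (u i)) atTop (𝓝 0) := by
    have e : ∀ i, inner ℂ h (u i) = ∑ k ∈ s, inner ℂ (g k) (u i k) := fun i => by
      rw [hh, sum_inner]
      exact Finset.sum_congr rfl fun k _ => lp.inner_single_left k (g k) (u i)
    simp only [e]
    have h0 : Tendsto (fun i => ∑ k ∈ s, inner ℂ (g k) (u i k)) atTop (𝓝 (∑ k ∈ s, 0)) := by
      refine tendsto_finsetSum s fun k _ => ?_
      have := (tendsto_const_nhds (x := g k)).inner (𝕜 := ℂ) (hu k)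
      rwa [inner_zero_right] at this
    rwa [Finset.sum_const_zero] at h0
  filter_upwards [(Metric.tendsto_nhds.mp h1) (ε / 2) (half_pos hε)] with i hi
  rw [dist_zero_right] at hi ⊢
  have hgh : ‖g - h‖ < ε / 2 / (C + 1) := by
    rw [← dist_eq_norm, dist_comm]
    exact hs
  have h2 : ‖inner ℂ (g - h) (u i)‖ ≤ ε / 2 := by
    refine (norm_inner_le_norm _ _).trans ?_
    calc ‖g - h‖ * ‖u i‖ ≤ (ε / 2 / (C + 1)) * (C + 1) := by
          gcongr
          linarith [hC i]
      _ = ε / 2 := by field_simp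
  calc ‖inner ℂ g (u i)‖ = ‖inner ℂ (g - h) (u i) + inner ℂ h (u i)‖ := by
        rw [← inner_add_left, sub_add_cancel]
    _ ≤ ‖inner ℂ (g - h) (u i)‖ + ‖inner ℂ h (u i)‖ := norm_add_le _ _
    _ < ε := by linarith

theorem tendsto_finiteRank_apply {H : Type*} [NormedAddCommGroup H] [InnerProductSpace ℂ H]
    [CompleteSpace H] {F : H →L[ℂ] H} (hF : F ∈ finiteRankOperators H) {u : ℕ → H}
    (hu : ∀ g, Tendsto (fun i => inner ℂ g (u i)) atTop (𝓝 0)) :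
    Tendsto (fun i => F (u i)) atTop (𝓝 0) := by
  have : FiniteDimensional ℂ (F : H →ₗ[ℂ] H).range :=
    (Submodule.fg_iff_finiteDimensional _).mp (mem_finiteRankOperators.mp hF)
  let b := stdOrthonormalBasis ℂ (F : H →ₗ[ℂ] H).range
  have e : ∀ i, F (u i) = ∑ j, inner ℂ (F.adjoint (b j)) (u i) • (b j : H) := fun i => by
    have h := b.sum_repr' ⟨F (u i), ⟨u i, rfl⟩⟩
    have h' : ((∑ j, inner ℂ (b j) ⟨F (u i), ⟨u i, rfl⟩⟩ • b j :
        (F : H →ₗ[ℂ] H).range) : H) = F (u i) := congrArg Subtype.val h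
    rw [← h']
    simp [ContinuousLinearMap.adjoint_inner_left]
  simp only [e]
  have h0 : Tendsto (fun i => ∑ j, inner ℂ (F.adjoint (b j)) (u i) • (b j : H)) atTop
      (𝓝 (∑ _j : Fin (Module.finrank ℂ (F : H →ₗ[ℂ] H).range), (0 : H))) := by
    refine tendsto_finsetSum _ fun j _ => ?_
    have := (hu (F.adjoint (b j))).smul_const (b j : H)
    rwa [zero_smul] at this
  rwa [Finset.sum_const_zero] at h0

end WeaklyNull

/-! ### Summability over the lattice -/

section Lattice

variable {n : ℕ}

theorem exists_summable_one_add_norm_pow_inv (n : ℕ) :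
    ∃ N : ℕ, Summable fun k : Fin n → ℤ => ((1 + ‖k‖) ^ N)⁻¹ := by
  let b := Pi.basisFun ℝ (Fin n)
  let L := Submodule.span ℤ (Set.range b)
  let N := Module.finrank ℤ L + 1
  have hs := ZLattice.summable_norm_pow_inv L N (Nat.lt_succ_self _)
  let φ : (Fin n → ℤ) → L := fun k => ⟨fun j => (k j : ℝ), by
    have : (fun j => (k j : ℝ)) = ∑ j, k j • b j := by
      ext i
      simp [b, Finset.sum_apply, Pi.single_apply]
    rw [this]
    exact Submodule.sum_mem _ fun j _ => Submodule.smul_mem _ _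
      (Submodule.subset_span ⟨j, rfl⟩)⟩
  have hφ : Function.Injective φ := fun k l h => by
    ext j
    have : (k j : ℝ) = l j := congrFun (congrArg Subtype.val h) j
    exact_mod_cast this
  have hnorm : ∀ k, ‖φ k‖ = ‖k‖ := fun k => by
    change ‖(fun j => (k j : ℝ))‖ = ‖k‖
    have h : ∀ j, ‖(k j : ℝ)‖₊ = ‖k j‖₊ := fun j => NNReal.eq (Int.norm_cast_real _)
    simp only [Pi.norm_def, h]
  refine ⟨N, Summable.of_norm_bounded_eventually (hs.comp_injective hφ) ?_⟩
  -- The origin is excluded because there the comparison term is `0⁻¹ ^ N = 0`.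
  filter_upwards [(Set.finite_singleton (0 : Fin n → ℤ)).compl_mem_cofinite] with k hk
  have hk' : 0 < ‖k‖ := norm_pos_iff.mpr hk
  rw [Function.comp_apply, hnorm, Real.norm_of_nonneg (by positivity), inv_pow]
  gcongr
  linarith

theorem exp_norm_mem_memℓp {ε : ℝ} (hε : 0 < ε) :
    Memℓp (fun k : Fin n → ℤ => (Real.exp (-ε * ‖k‖) : ℂ)) 2 := by
  obtain ⟨N, hN⟩ := exists_summable_one_add_norm_pow_inv n
  refine memℓp_two_of_summable ?_
  have hlim : Tendsto (fun x : ℝ => (1 + x) ^ N * Real.exp (-(2 * ε) * x)) atTop (𝓝 0) := by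
    have hε2 : 0 < 2 * ε := by positivity
    have h := (isLittleO_pow_exp_pos_mul_atTop N hε2).tendsto_div_nhds_zero
    -- The quotient of power by exponential is taken at `1 + x`; the factor `exp (2ε)` undoes the
    -- translation in the exponent.
    have h' := (h.comp (tendsto_atTop_add_const_left atTop (1 : ℝ) tendsto_id)).mul_const
      (Real.exp (2 * ε))
    rw [zero_mul] at h'
    refine h'.congr fun x => ?_
    simp only [Function.comp_apply, id_eq]
    rw [div_mul_eq_mul_div, mul_div_assoc, ← Real.exp_sub]
    congr 2
    ring
  have hev := (tendsto_norm_cocompact_atTop (E := Fin n → ℤ)).eventually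
    (hlim.eventually (Iio_mem_nhds one_pos))
  rw [cocompact_eq_cofinite] at hev
  refine Summable.of_norm_bounded_eventually hN ?_
  filter_upwards [hev] with k hk
  have hk0 : 0 < (1 + ‖k‖) ^ N := by positivity
  rw [Real.norm_of_nonneg (by positivity), Complex.norm_real, Real.norm_of_nonneg (Real.exp_pos _).le,
    ← Real.exp_nat_mul, ← one_div, le_div_iff₀ hk0, mul_comm]
  refine le_of_eq_of_le ?_ (le_of_lt hk)
  congr 2
  push_cast
  ring

end Lattice

/-! ### Wave packets -/

section WavePacket

variable {n : ℕ}

/-- The function `k ↦ exp (2πi k·x)` as a bounded function on `ℤⁿ`. -/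
noncomputable def latticeCharacter (x : UnitAddTorus (Fin n)) : lp (fun _ : Fin n → ℤ => ℂ) ∞ :=
  ⟨fun k => UnitAddTorus.mFourier k x, memℓp_infty ⟨1, by
    rintro _ ⟨k, rfl⟩
    exact (norm_mFourier_apply k x).le⟩⟩

theorem latticeCharacter_apply (x : UnitAddTorus (Fin n)) (k : Fin n → ℤ) :
    latticeCharacter x k = UnitAddTorus.mFourier k x := rfl

/-- The function `k ↦ exp (2πi k·x) ψ(k - p)`. -/
noncomputable def wavePacket (p : Fin n → ℤ) (x : UnitAddTorus (Fin n)) (ψ : EllTwo n) :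
    EllTwo n :=
  weightedShift (latticeCharacter x) (-p) ψ

theorem wavePacket_apply (p : Fin n → ℤ) (x : UnitAddTorus (Fin n)) (ψ : EllTwo n)
    (k : Fin n → ℤ) : wavePacket p x ψ k = UnitAddTorus.mFourier k x * ψ (k - p) := by
  rw [wavePacket, weightedShift_apply, latticeCharacter_apply, sub_eq_add_neg]

theorem norm_wavePacket (p : Fin n → ℤ) (x : UnitAddTorus (Fin n)) (ψ : EllTwo n) :
    ‖wavePacket p x ψ‖ = ‖ψ‖ := by
  rw [← sq_eq_sq₀ (norm_nonneg _) (norm_nonneg _), ellTwo_norm_sq, ellTwo_norm_sq,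
    ← (Equiv.subRight p).tsum_eq (fun k => ‖ψ k‖ ^ 2)]
  simp [wavePacket_apply, norm_mFourier_apply]

theorem tendsto_wavePacket_apply {p : ℕ → Fin n → ℤ} (hp : Tendsto p atTop cofinite)
    (x : ℕ → UnitAddTorus (Fin n)) (ψ : EllTwo n) (k : Fin n → ℤ) :
    Tendsto (fun i => wavePacket (p i) (x i) ψ k) atTop (𝓝 0) := by
  have h1 : Tendsto (fun l => ‖ψ l‖ ^ 2) cofinite (𝓝 0) :=
    (ellTwo_summable_sq ψ).tendsto_cofinite_zero
  have h2 : Tendsto (fun i => k - p i) atTop cofinite :=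
    (Equiv.subLeft k).injective.tendsto_cofinite.comp hp
  have h3 := (h1.comp h2).sqrt
  rw [Real.sqrt_zero] at h3
  refine squeeze_zero_norm (fun i => ?_) h3
  rw [wavePacket_apply, norm_mul, norm_mFourier_apply, one_mul, Function.comp_apply,
    Real.sqrt_sq (norm_nonneg _)]

/-- The `ℓ²` norm of `k ↦ (a(k) - a(p)) ψ(k - p)`. -/
noncomputable def localOscillation (a : lp (fun _ : Fin n → ℤ => ℂ) ∞) (ψ : EllTwo n)
    (p : Fin n → ℤ) : ℝ :=
  Real.sqrt (∑' l, ‖(a (p + l) - a p) * ψ l‖ ^ 2)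

theorem norm_sub_mul_sq_le (a : lp (fun _ : Fin n → ℤ => ℂ) ∞) (ψ : EllTwo n)
    (p l : Fin n → ℤ) : ‖(a (p + l) - a p) * ψ l‖ ^ 2 ≤ (2 * ‖a‖) ^ 2 * ‖ψ l‖ ^ 2 := by
  rw [norm_mul, mul_pow]
  have h1 := lp.norm_apply_le_norm (p := ∞) (by simp) a (p + l)
  have h2 := lp.norm_apply_le_norm (p := ∞) (by simp) a p
  have := norm_sub_le (a (p + l)) (a p)
  gcongr
  linarith

theorem localOscillation_le (a : lp (fun _ : Fin n → ℤ => ℂ) ∞) (ψ : EllTwo n)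
    (p : Fin n → ℤ) : localOscillation a ψ p ≤ 2 * ‖a‖ * ‖ψ‖ := by
  refine Real.sqrt_le_iff.mpr ⟨by positivity, ?_⟩
  rw [mul_pow, ellTwo_norm_sq ψ, ← tsum_mul_left]
  have hs := (ellTwo_summable_sq ψ).mul_left ((2 * ‖a‖) ^ 2)
  exact (Summable.of_nonneg_of_le (fun _ => by positivity) (norm_sub_mul_sq_le a ψ p)
    hs).tsum_le_tsum (norm_sub_mul_sq_le a ψ p) hs

/-- Dominated convergence in `l`: each increment `a(p + l) - a(p)` vanishes as `p → ∞`, with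
majorant `(2‖a‖)² ‖ψ l‖²`. -/
theorem tendsto_localOscillation {a : lp (fun _ : Fin n → ℤ => ℂ) ∞} (ψ : EllTwo n)
    (ha : ∀ η, Tendsto (fun k => a (k + η) - a k) cofinite (𝓝 0)) :
    Tendsto (localOscillation a ψ) cofinite (𝓝 0) := by
  have h := tendsto_tsum_of_dominated_convergence (𝓕 := cofinite)
    (f := fun p l => ‖(a (p + l) - a p) * ψ l‖ ^ 2) (g := fun _ => 0)
    ((ellTwo_summable_sq ψ).mul_left ((2 * ‖a‖) ^ 2)) (fun l => by
      have := (((ha l).mul_const (ψ l)).norm.pow 2)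
      simpa using this)
    (Eventually.of_forall fun p l => by
      rw [Real.norm_of_nonneg (by positivity)]
      exact norm_sub_mul_sq_le a ψ p l)
  have h' := h.sqrt
  rwa [tsum_zero, Real.sqrt_zero] at h'

/-- A shift multiplies the character by `exp (2πi η·x)` and moves the envelope. The first error term
comes from moving the envelope, the second from replacing `a(k)` by its value at the centre `p`. -/
theorem norm_weightedShift_wavePacket_sub_le (a : lp (fun _ : Fin n → ℤ => ℂ) ∞)
    (η p : Fin n → ℤ) (x : UnitAddTorus (Fin n)) (ψ : EllTwo n) :
    ‖weightedShift a η (wavePacket p x ψ) -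
        (a p * UnitAddTorus.mFourier η x) • wavePacket p x ψ‖ ≤
      ‖a‖ * ‖weightedShift 1 η ψ - ψ‖ + localOscillation a ψ p := by
  have h1 : ‖weightedShift a 0 (wavePacket p x (weightedShift 1 η ψ - ψ))‖ ≤
      ‖a‖ * ‖weightedShift 1 η ψ - ψ‖ := by
    rw [← norm_wavePacket p x (weightedShift 1 η ψ - ψ)]
    exact (weightedShift a 0).le_of_opNorm_le (norm_weightedShift_le a 0) _
  set v := weightedShift a 0 (wavePacket p x ψ) - a p • wavePacket p x ψ with hv
  have h2 : ‖v‖ = localOscillation a ψ p := by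
    rw [localOscillation, ← Real.sqrt_sq (norm_nonneg v), ellTwo_norm_sq,
      ← (Equiv.addLeft p).tsum_eq]
    congr 2 with k
    rw [hv, ellTwo_sub_apply, ellTwo_smul_apply, weightedShift_apply, wavePacket_apply, add_zero,
      wavePacket_apply, ← sub_mul, norm_mul, norm_mul, norm_mFourier_apply, one_mul, ← norm_mul,
      Equiv.coe_addLeft, add_sub_cancel_left]
  have h3 : weightedShift a η (wavePacket p x ψ) -
      (a p * UnitAddTorus.mFourier η x) • wavePacket p x ψ = UnitAddTorus.mFourier η x •
        (weightedShift a 0 (wavePacket p x (weightedShift 1 η ψ - ψ)) + v) := by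
    ext k
    simp only [hv, ellTwo_sub_apply, ellTwo_add_apply, ellTwo_smul_apply, weightedShift_apply,
      wavePacket_apply, add_zero, UnitAddTorus.mFourier_add, lp.infty_coeFn_one, Pi.one_apply,
      one_mul, add_sub_right_comm]
    ring
  rw [h3, norm_smul, norm_mFourier_apply, one_mul, ← h2]
  exact (norm_add_le _ _).trans (by gcongr)

theorem norm_shiftSeries_wavePacket_sub_le {σ : (Fin n → ℤ) → UnitAddTorus (Fin n) → ℂ}
    (hσ : HasSummableFourier σ) (p : Fin n → ℤ) (x : UnitAddTorus (Fin n)) (ψ : EllTwo n) :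
    ‖shiftSeries hσ.coeff (wavePacket p x ψ) - σ p x • wavePacket p x ψ‖ ≤
      ∑' η, ‖hσ.coeff η‖ * ‖weightedShift 1 η ψ - ψ‖ +
        ∑' η, localOscillation (hσ.coeff η) ψ p := by
  have h1 := (hasSum_shiftSeries hσ.summable_norm_coeff).mapL
    (ContinuousLinearMap.apply ℂ _ (wavePacket p x ψ))
  have h2 := (UnitAddTorus.hasSum_mFourier_series_apply_of_summable
    (f := ⟨σ p, hσ.continuous p⟩) (hσ.summable p) x).smul_const (wavePacket p x ψ)
  have h3 := h1.sub h2
  have hs1 : Summable fun η => ‖hσ.coeff η‖ * ‖weightedShift 1 η ψ - ψ‖ := by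
    refine .of_nonneg_of_le (fun _ => by positivity) (fun η => ?_)
      (hσ.summable_norm_coeff.mul_right (2 * ‖ψ‖))
    have h := (weightedShift 1 η).le_of_opNorm_le (norm_weightedShift_one_le η) ψ
    have := norm_sub_le (weightedShift 1 η ψ) ψ
    gcongr
    linarith
  have hs2 : Summable fun η => localOscillation (hσ.coeff η) ψ p := by
    refine .of_nonneg_of_le (fun _ => Real.sqrt_nonneg _) (fun η => localOscillation_le _ _ _)
      ((hσ.summable_norm_coeff.mul_left 2).mul_right ‖ψ‖)
  rw [← hs1.tsum_add hs2]
  exact h3.norm_le_of_bounded (hs1.add hs2).hasSum fun η =>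
    norm_weightedShift_wavePacket_sub_le (hσ.coeff η) η p x ψ

theorem tendsto_tsum_localOscillation {σ : (Fin n → ℤ) → UnitAddTorus (Fin n) → ℂ}
    (hσ : HasSummableFourier σ) (hσo : VanishingOscillation σ) (ψ : EllTwo n) :
    Tendsto (fun p => ∑' η, localOscillation (hσ.coeff η) ψ p) cofinite (𝓝 0) := by
  rw [← tsum_zero (α := ℝ) (β := Fin n → ℤ)]
  refine tendsto_tsum_of_dominated_convergence
    ((hσ.summable_norm_coeff.mul_left 2).mul_right ‖ψ‖)
    (fun η => tendsto_localOscillation ψ fun ζ => hσ.tendsto_coeff_sub (hσo ζ) η)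
    (Eventually.of_forall fun p η => ?_)
  rw [Real.norm_of_nonneg (show 0 ≤ localOscillation _ _ _ from Real.sqrt_nonneg _)]
  exact localOscillation_le _ _ _

/-- The function `k ↦ exp (-ε‖k‖)`. -/
noncomputable def expDecay {ε : ℝ} (hε : 0 < ε) : EllTwo n := ⟨_, exp_norm_mem_memℓp hε⟩

theorem expDecay_apply {ε : ℝ} (hε : 0 < ε) (k : Fin n → ℤ) :
    expDecay hε k = (Real.exp (-ε * ‖k‖) : ℂ) := rfl

theorem norm_expDecay_pos {ε : ℝ} (hε : 0 < ε) : 0 < ‖(expDecay hε : EllTwo n)‖ := by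
  refine lt_of_lt_of_le ?_ (lp.norm_apply_le_norm (by norm_num) (expDecay hε) 0)
  rw [expDecay_apply]
  simp

/-- Since `‖k + η‖` and `‖k‖` differ by at most `‖η‖`, the relative change is at most `exp (ε‖η‖) -
1`. The cap `2` supplies a bound uniform in `η`, needed for dominated convergence in
`exists_tsum_mul_min_lt`. -/
theorem norm_shift_expDecay_sub_le {ε : ℝ} (hε : 0 < ε) (η : Fin n → ℤ) :
    ‖weightedShift 1 η (expDecay hε) - expDecay hε‖ ≤
      min 2 (Real.exp (ε * ‖η‖) - 1) * ‖(expDecay hε : EllTwo n)‖ := by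
  rw [min_mul_of_nonneg _ _ (norm_nonneg _), le_min_iff]
  constructor
  · have h := (weightedShift 1 η).le_of_opNorm_le (norm_weightedShift_one_le η)
      (expDecay hε : EllTwo n)
    have := norm_sub_le (weightedShift 1 η (expDecay hε)) (expDecay hε : EllTwo n)
    linarith
  · have h0 : 0 ≤ Real.exp (ε * ‖η‖) - 1 := by
      rw [sub_nonneg, Real.one_le_exp_iff]
      positivity
    refine le_of_sq_le_sq ?_ (by positivity)
    rw [mul_pow, ellTwo_norm_sq, ellTwo_norm_sq, ← tsum_mul_left]
    refine (ellTwo_summable_sq _).tsum_le_tsum (fun k => ?_)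
      ((ellTwo_summable_sq _).mul_left _)
    rw [ellTwo_sub_apply, weightedShift_apply, lp.infty_coeFn_one, Pi.one_apply, one_mul,
      expDecay_apply, expDecay_apply, ← mul_pow, ← Complex.ofReal_sub, Complex.norm_real,
      Complex.norm_real, Real.norm_eq_abs, Real.norm_of_nonneg (Real.exp_pos _).le]
    gcongr
    have hsub := norm_sub_le (k + η) η
    rw [add_sub_cancel_right] at hsub
    have hadd := norm_add_le k η
    set E := Real.exp (ε * ‖η‖)
    have hE : 0 < E := Real.exp_pos _
    have h1 : Real.exp (-ε * ‖k + η‖) ≤ E * Real.exp (-ε * ‖k‖) := by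
      rw [← Real.exp_add, Real.exp_le_exp]
      nlinarith
    have h2 : E⁻¹ * Real.exp (-ε * ‖k‖) ≤ Real.exp (-ε * ‖k + η‖) := by
      rw [← Real.exp_neg, ← Real.exp_add, Real.exp_le_exp]
      nlinarith
    -- `E + E⁻¹ ≥ 2` converts the lower deviation `1 - E⁻¹` into the upper one `E - 1`.
    have h3 : 2 - E ≤ E⁻¹ := by
      rw [← one_div, le_div_iff₀ hE]
      nlinarith [sq_nonneg (E - 1)]
    have hpos := Real.exp_pos (-ε * ‖k‖)
    rw [abs_le]
    constructor <;> nlinarith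

theorem exists_tsum_mul_min_lt {B : (Fin n → ℤ) → ℝ} (hB : Summable B) (hB0 : ∀ η, 0 ≤ B η)
    {δ : ℝ} (hδ : 0 < δ) :
    ∃ ε > 0, ∑' η, B η * min 2 (Real.exp (ε * ‖η‖) - 1) < δ := by
  have h : Tendsto (fun ε : ℝ => ∑' η, B η * min 2 (Real.exp (ε * ‖η‖) - 1)) (𝓝[>] 0)
      (𝓝 (∑' _η : Fin n → ℤ, 0)) := by
    refine tendsto_tsum_of_dominated_convergence (hB.mul_right 2) (fun η => ?_) ?_
    · have hc : Continuous fun ε : ℝ => B η * min 2 (Real.exp (ε * ‖η‖) - 1) := by fun_prop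
      have := hc.tendsto 0
      simp only [zero_mul, Real.exp_zero, sub_self] at this
      rw [min_eq_right (by norm_num), mul_zero] at this
      exact this.mono_left nhdsWithin_le_nhds
    · filter_upwards [self_mem_nhdsWithin] with ε hε η
      have : 0 ≤ Real.exp (ε * ‖η‖) - 1 := by
        rw [sub_nonneg, Real.one_le_exp_iff]
        exact mul_nonneg (le_of_lt hε) (norm_nonneg _)
      rw [Real.norm_of_nonneg (mul_nonneg (hB0 η) (le_min (by norm_num) this))]
      exact mul_le_mul_of_nonneg_left (min_le_left _ _) (hB0 η)
  rw [tsum_zero] at h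
  obtain ⟨ε, hε, h⟩ := ((h.eventually (Iio_mem_nhds hδ)).and self_mem_nhdsWithin).exists
  exact ⟨ε, h, hε⟩

theorem not_tendsto_zero_of_isFredholm {σ : (Fin n → ℤ) → UnitAddTorus (Fin n) → ℂ}
    (hσ : HasSummableFourier σ) (hσo : VanishingOscillation σ)
    (hF : (shiftSeries hσ.coeff).IsFredholm) {p : ℕ → Fin n → ℤ}
    (hp : Tendsto p atTop cofinite) (x : ℕ → UnitAddTorus (Fin n)) :
    ¬ Tendsto (fun i => σ (p i) (x i)) atTop (𝓝 0) := by
  intro hlim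
  set T := shiftSeries hσ.coeff
  obtain ⟨v, hv⟩ := hF.exists_isQuasiInverse
  have hvT : v ∘L T - 1 ∈ finiteRankOperators (EllTwo n) :=
    mem_finiteRankOperators.mpr (LinearMap.FiniteRangeSetoid.equiv_iff_hasFiniteRange.mp hv.1)
  set F := v ∘L T - 1 with hFdef
  -- Write `u = v (T u) - F u` for a wave packet `u`. In the limit `F u`, the local oscillation and
  -- `σ(p_i, x_i)` all vanish, and only the defect of shift invariance of `ψ` remains.
  have key : ∀ ψ : EllTwo n,
      ‖ψ‖ ≤ ‖v‖ * ∑' η, ‖hσ.coeff η‖ * ‖weightedShift 1 η ψ - ψ‖ := fun ψ => by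
    have hbd : ∀ i, ‖wavePacket (p i) (x i) ψ‖ ≤ ‖ψ‖ := fun i => (norm_wavePacket _ _ _).le
    have hFu := (tendsto_finiteRank_apply hvT
      (tendsto_inner_of_tendsto_apply hbd (tendsto_wavePacket_apply hp x ψ))).norm
    have hosc := (tendsto_tsum_localOscillation hσ hσo ψ).comp hp
    have hR := (((tendsto_const_nhds (x := ∑' η, ‖hσ.coeff η‖ * ‖weightedShift 1 η ψ - ψ‖)).add
      hosc).add (hlim.norm.mul_const ‖ψ‖)).const_mul ‖v‖ |>.add hFu
    simp only [norm_zero, zero_mul, add_zero] at hR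
    refine ge_of_tendsto' hR fun i => ?_
    set u := wavePacket (p i) (x i) ψ with hu
    have hnu : ‖u‖ = ‖ψ‖ := norm_wavePacket _ _ _
    have h1 := norm_shiftSeries_wavePacket_sub_le hσ (p i) (x i) ψ
    rw [← hu] at h1
    have h2 : u = v (T u) - F u := by
      simp [hFdef]
    have h3 : ‖T u‖ ≤ ‖T u - σ (p i) (x i) • u‖ + ‖σ (p i) (x i)‖ * ‖u‖ := by
      rw [← norm_smul]
      exact norm_le_norm_sub_add _ _
    calc ‖ψ‖ = ‖v (T u) - F u‖ := by rw [← h2, hnu]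
      _ ≤ ‖v (T u)‖ + ‖F u‖ := norm_sub_le _ _
      _ ≤ ‖v‖ * ‖T u‖ + ‖F u‖ := by gcongr; exact v.le_opNorm _
      _ ≤ _ := by
        rw [hnu] at h3
        gcongr
        simp only [Function.comp_apply]
        linarith
  have hv0 : 0 < ‖v‖ + 1 := by positivity
  -- The bound `(‖v‖ + 1)⁻¹` makes the factor multiplying `‖ψ‖` in `key` less than `1`, which is
  -- impossible for `ψ ≠ 0`.
  obtain ⟨ε, hε, h⟩ := exists_tsum_mul_min_lt hσ.summable_norm_coeff (fun _ => norm_nonneg _)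
    (inv_pos.mpr hv0)
  have hmin : ∀ η : Fin n → ℤ, 0 ≤ min 2 (Real.exp (ε * ‖η‖) - 1) := fun η => by
    refine le_min (by norm_num) ?_
    rw [sub_nonneg, Real.one_le_exp_iff]
    positivity
  have hs : Summable fun η => ‖hσ.coeff η‖ * min 2 (Real.exp (ε * ‖η‖) - 1) :=
    .of_nonneg_of_le (fun η => mul_nonneg (norm_nonneg _) (hmin η))
      (fun η => mul_le_mul_of_nonneg_left (min_le_left _ _) (norm_nonneg _))
      (hσ.summable_norm_coeff.mul_right 2)
  have hle : ∀ η, ‖hσ.coeff η‖ * ‖weightedShift 1 η (expDecay hε) - expDecay hε‖ ≤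
      ‖hσ.coeff η‖ * min 2 (Real.exp (ε * ‖η‖) - 1) * ‖(expDecay hε : EllTwo n)‖ := fun η => by
    rw [mul_assoc]
    exact mul_le_mul_of_nonneg_left (norm_shift_expDecay_sub_le hε η) (norm_nonneg _)
  have h1 := (Summable.of_nonneg_of_le (fun _ => by positivity) hle
    (hs.mul_right ‖(expDecay hε : EllTwo n)‖)).tsum_le_tsum hle (hs.mul_right _)
  rw [tsum_mul_right] at h1
  have h2 := key (expDecay hε)
  have hψ := norm_expDecay_pos (n := n) hε
  set S := ∑' η, ‖hσ.coeff η‖ * min 2 (Real.exp (ε * ‖η‖) - 1)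
  have h3 : ‖v‖ * S < 1 := by
    have hS : 0 ≤ S := tsum_nonneg fun η => mul_nonneg (norm_nonneg _) (hmin η)
    have := mul_lt_mul_of_pos_left h hv0
    rw [mul_inv_cancel₀ hv0.ne'] at this
    linarith
  have h4 : ‖(expDecay hε : EllTwo n)‖ ≤ ‖v‖ * S * ‖(expDecay hε : EllTwo n)‖ := by
    rw [mul_assoc]
    exact h2.trans (mul_le_mul_of_nonneg_left h1 (norm_nonneg _))
  nlinarith

end WavePacket

/-! ### Smooth functions on the torus -/

section TorusSmooth

variable {n : ℕ}

/-- The `ℤⁿ`-periodic lift of a function on the torus. -/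
def torusLift (f : UnitAddTorus (Fin n) → ℂ) (y : Fin n → ℝ) : ℂ :=
  f fun j => (y j : UnitAddCircle)

theorem isOpenQuotientMap_torusMk :
    IsOpenQuotientMap fun (y : Fin n → ℝ) (j : Fin n) => (y j : UnitAddCircle) :=
  IsOpenQuotientMap.piMap fun _ => QuotientAddGroup.isOpenQuotientMap_mk

theorem TorusSmooth.continuous {f : UnitAddTorus (Fin n) → ℂ} (hf : TorusSmooth f) :
    Continuous f :=
  isOpenQuotientMap_torusMk.isQuotientMap.continuous_iff.mpr (ContDiff.continuous hf)

theorem apply_add_single_eq_torusLift (f : UnitAddTorus (Fin n) → ℂ) (j : Fin n) (y : Fin n → ℝ)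
    (t : ℝ) : f ((fun i => (y i : UnitAddCircle)) + Pi.single j (t : UnitAddCircle)) =
      torusLift f (y + t • Pi.single j 1) := by
  refine congrArg f (funext fun i => ?_)
  rcases eq_or_ne i j with rfl | h
  · simp
  · simp [h]

/-- `torusPartial` is a derivative at `t = 0`; translating the base point gives it at every `t`, as
differentiation under the integral requires. -/
theorem TorusSmooth.hasDerivAt {f : UnitAddTorus (Fin n) → ℂ} (hf : TorusSmooth f) (j : Fin n)
    (x : UnitAddTorus (Fin n)) (t : ℝ) :
    HasDerivAt (fun t : ℝ => f (x + Pi.single j (t : UnitAddCircle)))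
      (torusPartial j f (x + Pi.single j (t : UnitAddCircle))) t := by
  have hd : ∀ x : UnitAddTorus (Fin n), Differentiable ℝ
      fun t : ℝ => f (x + Pi.single j (t : UnitAddCircle)) := fun x => by
    obtain ⟨y, rfl⟩ := isOpenQuotientMap_torusMk.surjective x
    simp only [apply_add_single_eq_torusLift]
    exact (ContDiff.differentiable hf (by simp)).comp (by fun_prop)
  have h := (hd (x + Pi.single j (t : UnitAddCircle)) 0).hasDerivAt
  have h0 : HasDerivAt (fun s : ℝ => f (x + Pi.single j (t : UnitAddCircle) +
      Pi.single j (s : UnitAddCircle))) (torusPartial j f (x + Pi.single j (t : UnitAddCircle)))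
      (t - t) := by
    rw [sub_self]
    exact h
  refine (h0.comp_sub_const t t).congr_of_eventuallyEq (Eventually.of_forall fun s => ?_)
  dsimp only
  rw [add_assoc, ← Pi.single_add, ← AddCircle.coe_add, add_sub_cancel]

theorem TorusSmooth.torusLift_torusPartial {f : UnitAddTorus (Fin n) → ℂ} (hf : TorusSmooth f)
    (j : Fin n) (y : Fin n → ℝ) :
    torusLift (torusPartial j f) y = fderiv ℝ (torusLift f) y (Pi.single j 1) := by
  change deriv (fun t : ℝ => f ((fun i => (y i : UnitAddCircle)) +
    Pi.single j (t : UnitAddCircle))) 0 = _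
  simp only [apply_add_single_eq_torusLift]
  have h : HasFDerivAt (torusLift f) (fderiv ℝ (torusLift f) y) y :=
    (ContDiff.differentiable hf (by simp) y).hasFDerivAt
  exact (h.hasLineDerivAt (Pi.single j 1)).deriv

theorem TorusSmooth.smooth_torusPartial {f : UnitAddTorus (Fin n) → ℂ} (hf : TorusSmooth f)
    (j : Fin n) : TorusSmooth (torusPartial j f) := by
  have h : ContDiff ℝ ∞ fun y => fderiv ℝ (torusLift f) y (Pi.single j 1) :=
    (ContDiff.fderiv_right hf (by simp)).clm_apply contDiff_const
  simp only [← hf.torusLift_torusPartial] at h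
  exact h

theorem TorusSmooth.const (c : ℂ) : TorusSmooth fun _ : UnitAddTorus (Fin n) => c :=
  contDiff_const

theorem TorusSmooth.add {f g : UnitAddTorus (Fin n) → ℂ} (hf : TorusSmooth f)
    (hg : TorusSmooth g) : TorusSmooth fun x => f x + g x :=
  ContDiff.add hf hg

theorem TorusSmooth.sub {f g : UnitAddTorus (Fin n) → ℂ} (hf : TorusSmooth f)
    (hg : TorusSmooth g) : TorusSmooth fun x => f x - g x :=
  ContDiff.sub hf hg

theorem TorusSmooth.mul {f g : UnitAddTorus (Fin n) → ℂ} (hf : TorusSmooth f)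
    (hg : TorusSmooth g) : TorusSmooth fun x => f x * g x :=
  ContDiff.mul hf hg

theorem TorusSmooth.inv {f : UnitAddTorus (Fin n) → ℂ} (hf : TorusSmooth f)
    (h : ∀ x, f x ≠ 0) : TorusSmooth fun x => (f x)⁻¹ :=
  ContDiff.inv hf fun _ => h _

theorem TorusSmooth.hasDerivAt_zero {f : UnitAddTorus (Fin n) → ℂ} (hf : TorusSmooth f)
    (j : Fin n) (x : UnitAddTorus (Fin n)) :
    HasDerivAt (fun t : ℝ => f (x + Pi.single j (t : UnitAddCircle))) (torusPartial j f x) 0 := by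
  simpa using hf.hasDerivAt j x 0

theorem TorusSmooth.torusPartial_add {f g : UnitAddTorus (Fin n) → ℂ} (hf : TorusSmooth f)
    (hg : TorusSmooth g) (j : Fin n) : torusPartial j (fun x => f x + g x) =
      fun x => torusPartial j f x + torusPartial j g x :=
  funext fun x => ((hf.hasDerivAt_zero j x).add (hg.hasDerivAt_zero j x)).deriv

theorem TorusSmooth.torusPartial_const_mul {f : UnitAddTorus (Fin n) → ℂ} (hf : TorusSmooth f)
    (c : ℂ) (j : Fin n) : torusPartial j (fun x => c * f x) =
      fun x => c * torusPartial j f x :=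
  funext fun x => ((hf.hasDerivAt_zero j x).const_mul c).deriv

theorem TorusSmooth.torusPartial_mul {f g : UnitAddTorus (Fin n) → ℂ} (hf : TorusSmooth f)
    (hg : TorusSmooth g) (j : Fin n) : torusPartial j (fun x => f x * g x) =
      fun x => torusPartial j f x * g x + f x * torusPartial j g x :=
  funext fun x => by
    have := ((hf.hasDerivAt_zero j x).mul (hg.hasDerivAt_zero j x)).deriv
    simp only [AddCircle.coe_zero, Pi.single_zero, add_zero] at this
    exact this

/-- The derivative is written as a product of `∂f` and two copies of `f⁻¹` so that closure of
`BoundedPartials` under products applies directly. -/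
theorem TorusSmooth.torusPartial_inv {f : UnitAddTorus (Fin n) → ℂ} (hf : TorusSmooth f)
    (h : ∀ x, f x ≠ 0) (j : Fin n) : torusPartial j (fun x => (f x)⁻¹) =
      fun x => -1 * (torusPartial j f x * ((f x)⁻¹ * (f x)⁻¹)) :=
  funext fun x => by
    have := ((hf.hasDerivAt_zero j x).inv (h _)).deriv
    refine this.trans ?_
    have := h x
    simp only [AddCircle.coe_zero, Pi.single_zero, add_zero]
    field_simp

instance : (torusMeasure n).IsAddLeftInvariant :=
  inferInstanceAs ((Measure.pi fun _ : Fin n =>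
    (AddCircle.haarAddCircle : Measure UnitAddCircle)).IsAddLeftInvariant)

theorem mFourier_add_single (η : Fin n → ℤ) (x : UnitAddTorus (Fin n)) (j : Fin n) (t : ℝ) :
    UnitAddTorus.mFourier η (x + Pi.single j (t : UnitAddCircle)) =
      UnitAddTorus.mFourier η x * Complex.exp (2 * Real.pi * Complex.I * η j * t) := by
  have h : ∀ i, fourier (η i) ((x + Pi.single j (t : UnitAddCircle) : UnitAddTorus (Fin n)) i) =
      fourier (η i) (x i) *
        fourier (η i) ((Pi.single j (t : UnitAddCircle) : UnitAddTorus (Fin n)) i) := fun i => by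
    simp only [fourier_apply, Pi.add_apply, smul_add, AddCircle.toCircle_add, Circle.coe_mul]
  simp only [UnitAddTorus.mFourier, ContinuousMap.coe_mk, h, Finset.prod_mul_distrib]
  congr 1
  rw [Finset.prod_eq_single j (fun i _ hi => by simp [hi]) (by simp), Pi.single_eq_same,
    fourier_coe_apply]
  simp

/-- Translation invariance of Haar measure moves the shift onto the character. Differentiating both
sides at `t = 0` gives the Fourier coefficients of a partial derivative. -/
theorem integral_mFourier_mul_shift (f : UnitAddTorus (Fin n) → ℂ) (j : Fin n)
    (η : Fin n → ℤ) (t : ℝ) :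
    ∫ x, UnitAddTorus.mFourier (-η) x * f (x + Pi.single j (t : UnitAddCircle))
      ∂(torusMeasure n) =
      Complex.exp (2 * Real.pi * Complex.I * η j * t) * UnitAddTorus.mFourierCoeff f η := by
  rw [mFourierCoeff_eq_integral_torusMeasure, ← integral_const_mul,
    ← integral_add_right_eq_self (μ := torusMeasure n)
      (fun x => Complex.exp (2 * Real.pi * Complex.I * η j * t) *
        (UnitAddTorus.mFourier (-η) x * f x)) (Pi.single j (t : UnitAddCircle))]
  congr with x
  rw [mFourier_add_single]
  have : Complex.exp (2 * Real.pi * Complex.I * η j * t) *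
      Complex.exp (2 * Real.pi * Complex.I * ((-η) j : ℤ) * t) = 1 := by
    rw [← Complex.exp_add, Pi.neg_apply, Int.cast_neg, ← Complex.exp_zero]
    congr 1
    ring
  linear_combination -(UnitAddTorus.mFourier (-η) x *
    f (x + Pi.single j (t : UnitAddCircle))) * this

theorem TorusSmooth.hasDerivAt_integral_shift {f : UnitAddTorus (Fin n) → ℂ}
    (hf : TorusSmooth f) (j : Fin n) (η : Fin n → ℤ) :
    HasDerivAt (fun t : ℝ => ∫ x, UnitAddTorus.mFourier (-η) x *
      f (x + Pi.single j (t : UnitAddCircle)) ∂(torusMeasure n))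
      (UnitAddTorus.mFourierCoeff (torusPartial j f) η) 0 := by
  have hcont := (hf.smooth_torusPartial j).continuous
  obtain ⟨C, hC⟩ := (isCompact_range hcont).isBounded.exists_norm_le
  have hf' := hf.continuous
  have hm := (UnitAddTorus.mFourier (-η)).continuous
  have hF (t : ℝ) : Continuous fun x => UnitAddTorus.mFourier (-η) x *
      f (x + Pi.single j (t : UnitAddCircle)) :=
    hm.mul (hf'.comp (continuous_add_const _))
  have hF' : Continuous fun x => UnitAddTorus.mFourier (-η) x *
      torusPartial j f (x + Pi.single j ((0 : ℝ) : UnitAddCircle)) :=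
    hm.mul (hcont.comp (continuous_add_const _))
  have hbound : ∀ᵐ x ∂(torusMeasure n), ∀ t ∈ (Set.univ : Set ℝ),
      ‖UnitAddTorus.mFourier (-η) x * torusPartial j f (x + Pi.single j (t : UnitAddCircle))‖
        ≤ C := Eventually.of_forall fun x t _ => by
    rw [norm_mul, norm_mFourier_apply, one_mul]
    exact hC _ ⟨_, rfl⟩
  have hderiv : ∀ᵐ x ∂(torusMeasure n), ∀ t ∈ (Set.univ : Set ℝ),
      HasDerivAt (fun t : ℝ => UnitAddTorus.mFourier (-η) x *
        f (x + Pi.single j (t : UnitAddCircle))) (UnitAddTorus.mFourier (-η) x *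
        torusPartial j f (x + Pi.single j (t : UnitAddCircle))) t :=
    Eventually.of_forall fun x t _ => (hf.hasDerivAt j x t).const_mul _
  have h := (hasDerivAt_integral_of_dominated_loc_of_deriv_le univ_mem
    (Eventually.of_forall fun t => (hF t).aestronglyMeasurable)
    ((hF 0).integrable_of_hasCompactSupport (HasCompactSupport.of_compactSpace _))
    hF'.aestronglyMeasurable hbound (integrable_const C) hderiv).2
  rw [AddCircle.coe_zero, Pi.single_zero] at h
  simp only [add_zero] at h
  exact h

/-- Differentiation multiplies Fourier coefficients by `2πiη_j`. -/
theorem TorusSmooth.mFourierCoeff_torusPartial {f : UnitAddTorus (Fin n) → ℂ}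
    (hf : TorusSmooth f) (j : Fin n) (η : Fin n → ℤ) :
    UnitAddTorus.mFourierCoeff (torusPartial j f) η =
      2 * Real.pi * Complex.I * η j * UnitAddTorus.mFourierCoeff f η := by
  have h1 := hf.hasDerivAt_integral_shift j η
  simp only [integral_mFourier_mul_shift] at h1
  refine h1.unique (HasDerivAt.mul_const ?_ _)
  have := ((hasDerivAt_id (0 : ℂ)).const_mul (2 * Real.pi * Complex.I * η j)).cexp.comp_ofReal
    (z := 0)
  simpa using this

end TorusSmooth

/-! ### Families of smooth functions with uniformly bounded derivatives -/

section UniformlySmooth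

variable {n : ℕ} {ι : Type*} {j : Fin n} {N : ℕ} {σ τ : ι → UnitAddTorus (Fin n) → ℂ}

/-- A uniformly bounded family of smooth functions. -/
def BoundedSmooth (σ : ι → UnitAddTorus (Fin n) → ℂ) : Prop :=
  (∀ k, TorusSmooth (σ k)) ∧ ∃ C, ∀ k x, ‖σ k x‖ ≤ C

/-- A family of smooth functions whose derivatives `(∂/∂x_j)^m`, `m ≤ N`, are uniformly
bounded. -/
def BoundedPartials (j : Fin n) : ℕ → (ι → UnitAddTorus (Fin n) → ℂ) → Prop
  | 0, σ => BoundedSmooth σ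
  | N + 1, σ => BoundedSmooth σ ∧ BoundedPartials j N fun k => torusPartial j (σ k)

theorem BoundedSmooth.mul (hσ : BoundedSmooth σ) (hτ : BoundedSmooth τ) :
    BoundedSmooth fun k x => σ k x * τ k x := by
  obtain ⟨hσ, C, hC⟩ := hσ
  obtain ⟨hτ, D, hD⟩ := hτ
  refine ⟨fun k => (hσ k).mul (hτ k), C * D, fun k x => ?_⟩
  rw [norm_mul]
  exact mul_le_mul (hC k x) (hD k x) (norm_nonneg _) ((norm_nonneg _).trans (hC k x))

theorem BoundedSmooth.add (hσ : BoundedSmooth σ) (hτ : BoundedSmooth τ) :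
    BoundedSmooth fun k x => σ k x + τ k x := by
  obtain ⟨hσ, C, hC⟩ := hσ
  obtain ⟨hτ, D, hD⟩ := hτ
  exact ⟨fun k => (hσ k).add (hτ k), C + D, fun k x => norm_add_le_of_le (hC k x) (hD k x)⟩

theorem BoundedSmooth.const (c : ℂ) :
    BoundedSmooth fun (_ : ι) (_ : UnitAddTorus (Fin n)) => c :=
  ⟨fun _ => .const c, ‖c‖, fun _ _ => le_rfl⟩

theorem BoundedSmooth.const_mul (hσ : BoundedSmooth σ) (c : ℂ) :
    BoundedSmooth fun k x => c * σ k x :=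
  (BoundedSmooth.const c).mul hσ

theorem BoundedSmooth.ite (hσ : BoundedSmooth σ) (hτ : BoundedSmooth τ) (p : ι → Prop)
    [DecidablePred p] : BoundedSmooth fun k => if p k then σ k else τ k := by
  obtain ⟨hσ, C, hC⟩ := hσ
  obtain ⟨hτ, D, hD⟩ := hτ
  refine ⟨fun k => ?_, max C D, fun k x => ?_⟩
  · dsimp only
    split_ifs
    exacts [hσ k, hτ k]
  · dsimp only
    split_ifs
    exacts [(hC k x).trans (le_max_left _ _), (hD k x).trans (le_max_right _ _)]

namespace BoundedPartials

theorem boundedSmooth (h : BoundedPartials j N σ) : BoundedSmooth σ := by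
  cases N with
  | zero => exact h
  | succ N => exact h.1

theorem of_succ (h : BoundedPartials j (N + 1) σ) : BoundedPartials j N σ := by
  induction N generalizing σ with
  | zero => exact h.1
  | succ N ih => exact ⟨h.1, ih h.2⟩

theorem add (hσ : BoundedPartials j N σ) (hτ : BoundedPartials j N τ) :
    BoundedPartials j N fun k x => σ k x + τ k x := by
  induction N generalizing σ τ with
  | zero => exact BoundedSmooth.add hσ hτ
  | succ N ih =>
    refine ⟨hσ.1.add hτ.1, ?_⟩
    simp only [(hσ.1.1 _).torusPartial_add (hτ.1.1 _)]
    exact ih hσ.2 hτ.2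

theorem const_mul (hσ : BoundedPartials j N σ) (c : ℂ) :
    BoundedPartials j N fun k x => c * σ k x := by
  induction N generalizing σ with
  | zero => exact BoundedSmooth.const_mul hσ c
  | succ N ih =>
    refine ⟨hσ.1.const_mul c, ?_⟩
    simp only [(hσ.1.1 _).torusPartial_const_mul]
    exact ih hσ.2

theorem mul (hσ : BoundedPartials j N σ) (hτ : BoundedPartials j N τ) :
    BoundedPartials j N fun k x => σ k x * τ k x := by
  induction N generalizing σ τ with
  | zero => exact BoundedSmooth.mul hσ hτ
  | succ N ih =>
    refine ⟨hσ.1.mul hτ.1, ?_⟩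
    simp only [(hσ.1.1 _).torusPartial_mul (hτ.1.1 _)]
    exact (ih hσ.2 hτ.of_succ).add (ih hσ.of_succ hτ.2)

theorem inv (hσ : BoundedPartials j N σ) {c : ℝ} (hc : 0 < c) (h : ∀ k x, c ≤ ‖σ k x‖) :
    BoundedPartials j N fun k x => (σ k x)⁻¹ := by
  have h0 : ∀ k x, σ k x ≠ 0 := fun k x => norm_pos_iff.mp (hc.trans_le (h k x))
  have hb : BoundedSmooth fun k x => (σ k x)⁻¹ :=
    ⟨fun k => (hσ.boundedSmooth.1 k).inv (h0 k), c⁻¹, fun k x => by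
      rw [norm_inv]
      exact inv_anti₀ hc (h k x)⟩
  induction N with
  | zero => exact hb
  | succ N ih =>
    refine ⟨hb, ?_⟩
    simp only [fun k => (hσ.1.1 k).torusPartial_inv (h0 k)]
    -- The derivative of the reciprocal involves the reciprocal only with one derivative fewer, so
    -- the induction closes.
    exact (hσ.2.mul ((ih hσ.of_succ).mul (ih hσ.of_succ))).const_mul (-1)

theorem const (c : ℂ) (N : ℕ) :
    BoundedPartials j N fun (_ : ι) (_ : UnitAddTorus (Fin n)) => c := by
  induction N generalizing c with
  | zero => exact BoundedSmooth.const c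
  | succ N ih =>
    refine ⟨BoundedSmooth.const c, ?_⟩
    have : torusPartial j (fun _ : UnitAddTorus (Fin n) => c) = fun _ => 0 :=
      funext fun x => deriv_const _ _
    simp only [this]
    exact ih 0

theorem ite (hσ : BoundedPartials j N σ) (hτ : BoundedPartials j N τ) (p : ι → Prop)
    [DecidablePred p] : BoundedPartials j N fun k => if p k then σ k else τ k := by
  induction N generalizing σ τ with
  | zero => exact BoundedSmooth.ite hσ hτ p
  | succ N ih =>
    refine ⟨hσ.1.ite hτ.1 p, ?_⟩
    simp only [apply_ite (torusPartial j)]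
    exact ih hσ.2 hτ.2

/-- Each derivative contributes a factor `2πη_j`, and `2π ≥ 1` can be dropped. -/
theorem exists_pow_mul_norm_mFourierCoeff_le (h : BoundedPartials j N σ) :
    ∃ C, ∀ k η, ‖η j‖ ^ N * ‖UnitAddTorus.mFourierCoeff (σ k) η‖ ≤ C := by
  induction N generalizing σ with
  | zero =>
    obtain ⟨-, C, hC⟩ := h
    exact ⟨C, fun k η => by simpa using norm_mFourierCoeff_le (hC k) η⟩
  | succ N ih =>
    obtain ⟨C, hC⟩ := ih h.2
    refine ⟨C, fun k η => le_trans ?_ (hC k η)⟩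
    rw [(h.1.1 k).mFourierCoeff_torusPartial, pow_succ, mul_assoc, norm_mul (_ * _)]
    gcongr
    rw [norm_mul, Complex.norm_intCast, ← Int.norm_eq_abs]
    refine le_mul_of_one_le_left (norm_nonneg _) ?_
    simp only [norm_mul, Complex.norm_I, Complex.norm_real, Complex.norm_ofNat, mul_one,
      Real.norm_of_nonneg Real.pi_pos.le]
    linarith [Real.pi_gt_three]

end BoundedPartials

theorem hasSummableFourier_of_boundedPartials
    {σ : (Fin n → ℤ) → UnitAddTorus (Fin n) → ℂ} (h0 : BoundedSmooth σ)
    (h : ∀ j N, BoundedPartials j N σ) : HasSummableFourier σ := by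
  refine ⟨fun k => (h0.1 k).continuous, ?_⟩
  obtain ⟨N, hN⟩ := exists_summable_one_add_norm_pow_inv n
  obtain ⟨C₀, hC₀⟩ := h0.2
  choose C hC using fun j => (h j N).exists_pow_mul_norm_mFourierCoeff_le
  have hC0 : ∀ j, 0 ≤ C j := fun j => le_trans (by positivity) (hC j 0 0)
  have hC₀' : 0 ≤ C₀ := (norm_nonneg _).trans (hC₀ 0 0)
  refine ⟨_, hN.mul_left (2 ^ N * (C₀ + ∑ j, C j)), fun k η => ?_⟩
  rw [← div_eq_mul_inv, le_div_iff₀ (by positivity)]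
  have hb := norm_mFourierCoeff_le (hC₀ k) η
  have hsum : 0 ≤ ∑ j, C j := Finset.sum_nonneg fun j _ => hC0 j
  set a := ‖UnitAddTorus.mFourierCoeff (σ k) η‖
  have ha : 0 ≤ a := norm_nonneg _
  rcases le_or_gt ‖η‖ 1 with hη | hη
  · calc a * (1 + ‖η‖) ^ N ≤ C₀ * 2 ^ N := by
          gcongr
          linarith
      _ ≤ _ := by
          rw [mul_comm]
          gcongr
          linarith
  -- For `‖η‖ > 1` the largest coordinate satisfies `1 + ‖η‖ ≤ 2‖η j‖`, so pure derivatives in one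
  -- direction suffice. A largest coordinate needs `n ≠ 0`, and this follows from `η ≠ 0`.
  · have : Nonempty (Fin n) := by
      by_contra hne
      rw [not_nonempty_iff] at hne
      rw [Subsingleton.elim η 0, norm_zero] at hη
      linarith
    obtain ⟨j, hj⟩ := Finite.exists_max fun j => ‖η j‖
    have hηj : ‖η‖ ≤ ‖η j‖ := (pi_norm_le_iff_of_nonneg (norm_nonneg _)).mpr hj
    calc a * (1 + ‖η‖) ^ N ≤ a * (2 * ‖η j‖) ^ N := by
          gcongr
          linarith
      _ = 2 ^ N * (‖η j‖ ^ N * a) := by ring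
      _ ≤ 2 ^ N * (C₀ + ∑ j, C j) := by
          gcongr
          exact (hC j k η).trans ((Finset.single_le_sum (fun i _ => hC0 i)
            (Finset.mem_univ j)).trans (le_add_of_nonneg_left hC₀'))

end UniformlySmooth

/-! ### Vanishing oscillation -/

section Oscillation

variable {n : ℕ} {σ : (Fin n → ℤ) → UnitAddTorus (Fin n) → ℂ}

/-- The shifts along which the oscillation vanishes form a subgroup, and the `e_j` generate `ℤⁿ`. -/
theorem vanishingOscillation_of_single
    (h : ∀ j : Fin n, ∀ ε > 0, ∀ᶠ k in cofinite, ∀ x,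
      ‖σ (k + Pi.single j 1) x - σ k x‖ ≤ ε) : VanishingOscillation σ := by
  let V : AddSubgroup (Fin n → ℤ) :=
    { carrier := {η | ∀ ε > 0, ∀ᶠ k in cofinite, ∀ x, ‖σ (k + η) x - σ k x‖ ≤ ε}
      zero_mem' := fun ε hε => Eventually.of_forall fun k x => by simpa using hε.le
      add_mem' := fun {η ζ} hη hζ ε hε => by
        have h1 := (add_left_injective η).tendsto_cofinite.eventually (hζ (ε / 2) (half_pos hε))
        filter_upwards [hη (ε / 2) (half_pos hε), h1] with k hk1 hk2 x
        have := norm_sub_le_norm_sub_add_norm_sub (σ (k + η + ζ) x) (σ (k + η) x) (σ k x)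
        rw [← add_assoc]
        linarith [hk1 x, hk2 x]
      neg_mem' := fun {η} hη ε hε => by
        have h1 := (add_left_injective (-η)).tendsto_cofinite.eventually (hη ε hε)
        filter_upwards [h1] with k hk x
        have := hk x
        rwa [neg_add_cancel_right, norm_sub_rev] at this }
  intro η
  have hη : η = ∑ j, η j • (Pi.single j 1 : Fin n → ℤ) := by
    ext i
    simp [Finset.sum_apply, Pi.single_apply]
  have : η ∈ V := by
    rw [hη]
    exact V.sum_mem fun j _ => V.zsmul_mem (h j) _
  exact this

theorem VanishingOscillation.congr {τ : (Fin n → ℤ) → UnitAddTorus (Fin n) → ℂ}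
    (h : VanishingOscillation σ) (hστ : ∀ᶠ k in cofinite, σ k = τ k) :
    VanishingOscillation τ := by
  intro η ε hε
  filter_upwards [h η ε hε, hστ, (add_left_injective η).tendsto_cofinite.eventually hστ]
    with k hk h1 h2 x
  rw [← h1, ← h2]
  exact hk x

theorem VanishingOscillation.inv (h : VanishingOscillation σ) {c : ℝ} (hc : 0 < c)
    (hσ : ∀ k x, c ≤ ‖σ k x‖) : VanishingOscillation fun k x => (σ k x)⁻¹ := by
  intro η ε hε
  filter_upwards [h η (ε * (c * c)) (by positivity)] with k hk x
  have h1 : σ (k + η) x ≠ 0 := norm_pos_iff.mp (hc.trans_le (hσ _ _))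
  have h2 : σ k x ≠ 0 := norm_pos_iff.mp (hc.trans_le (hσ _ _))
  rw [inv_sub_inv h1 h2, norm_div, norm_mul, norm_sub_rev,
    div_le_iff₀ (mul_pos (norm_pos_iff.mpr h1) (norm_pos_iff.mpr h2))]
  refine (hk x).trans ?_
  gcongr
  exacts [hσ _ _, hσ _ _]

end Oscillation

/-! ### The symbol classes -/

section SymbolClass

variable {n : ℕ}

/-- Used to reduce a multi-index operator supported on one coordinate to the operator in that
coordinate. -/
theorem foldr_eq_of_nodup {α β : Type*} (F : α → β → β) (j : α) (hF : ∀ i ≠ j, F i = id)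
    {l : List α} (hl : l.Nodup) (hj : j ∈ l) (b : β) :
    l.foldr (fun i c => F i c) b = F j b := by
  have key : ∀ l : List α, j ∉ l → l.foldr (fun i c => F i c) b = b := fun l hl => by
    induction l with
    | nil => rfl
    | cons i l ih =>
      rw [List.mem_cons, not_or] at hl
      rw [List.foldr_cons, ih hl.2, hF i (Ne.symm hl.1), id]
  induction l with
  | nil => simp at hj
  | cons i l ih =>
    rw [List.nodup_cons] at hl
    rw [List.foldr_cons]
    rcases eq_or_ne i j with rfl | hij
    · rw [key l hl.1]
    · rw [hF i hij, id, ih hl.2]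
      exact (List.mem_cons.mp hj).resolve_left hij.symm

theorem toroidalDerivMulti_single (j : Fin n) (ℓ : ℕ) (f : UnitAddTorus (Fin n) → ℂ) :
    toroidalDerivMulti (Pi.single j ℓ) f = toroidalDeriv j ℓ f := by
  rw [toroidalDerivMulti, foldr_eq_of_nodup
    (fun i g => toroidalDeriv i ((Pi.single j ℓ : Fin n → ℕ) i) g) j
    (fun i hi => by rw [Pi.single_eq_of_ne hi]; rfl) (List.nodup_finRange n)
    (List.mem_finRange j), Pi.single_eq_same]

theorem toroidalDerivMulti_zero (f : UnitAddTorus (Fin n) → ℂ) : toroidalDerivMulti 0 f = f := by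
  unfold toroidalDerivMulti
  induction List.finRange n with
  | nil => rfl
  | cons i l ih => rw [List.foldr_cons, ih]; rfl

theorem latticeDiff_single {G : Type*} [AddCommGroup G] (j : Fin n) (a : (Fin n → ℤ) → G) :
    latticeDiff (Pi.single j 1) a = fwdDiff (Pi.single j (1 : ℤ)) a := by
  rw [latticeDiff, foldr_eq_of_nodup
    (fun i b => (fwdDiff (Pi.single i (1 : ℤ)))^[(Pi.single j 1 : Fin n → ℕ) i] b) j
    (fun i hi => by rw [Pi.single_eq_of_ne hi]; rfl) (List.nodup_finRange n)
    (List.mem_finRange j), Pi.single_eq_same]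
  rfl

theorem latticeDiff_zero {G : Type*} [AddCommGroup G] (a : (Fin n → ℤ) → G) :
    latticeDiff 0 a = a := by
  unfold latticeDiff
  induction List.finRange n with
  | nil => rfl
  | cons i l ih => rw [List.foldr_cons, ih]; rfl

variable {Λ : (Fin n → ℤ) → ℝ} {μ ρ m : ℝ} {σ : (Fin n → ℤ) → UnitAddTorus (Fin n) → ℂ}

theorem IsSymbolM.isSymbolS (h : IsSymbolM Λ ρ m σ) : IsSymbolS Λ ρ m σ := by
  have := h.mem 0 fun _ => Nat.zero_le _
  simpa [latticeDiff_zero, latticeMonomial] using this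

theorem IsSymbolS.norm_toroidalDeriv_le (h : IsSymbolS Λ ρ 0 σ) (j : Fin n) (ℓ : ℕ) :
    ∃ C, ∀ k x, ‖toroidalDeriv j ℓ (σ k) x‖ ≤ C := by
  obtain ⟨C, -, hC⟩ := h.bound 0 (Pi.single j ℓ)
  refine ⟨C, fun k x => ?_⟩
  simpa [latticeDiff_zero, toroidalDerivMulti_single, multiOrder] using hC k x

theorem IsSymbolS.boundedSmooth (h : IsSymbolS Λ ρ 0 σ) : BoundedSmooth σ := by
  obtain ⟨C, -, hC⟩ := h.bound 0 0
  refine ⟨h.smooth, C, fun k x => ?_⟩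
  simpa [latticeDiff_zero, toroidalDerivMulti_zero, multiOrder] using hC k x

theorem TorusSmooth.toroidalDeriv {f : UnitAddTorus (Fin n) → ℂ} (hf : TorusSmooth f)
    (j : Fin n) (ℓ : ℕ) : TorusSmooth (toroidalDeriv j ℓ f) := by
  induction ℓ with
  | zero => exact hf
  | succ ℓ ih =>
    exact ((TorusSmooth.const _).mul (ih.smooth_torusPartial j)).sub ((TorusSmooth.const _).mul ih)

/-- Solving the defining recursion for the ordinary derivative lets bounds on the toroidal
derivatives pass to iterated partial derivatives. -/
theorem torusPartial_toroidalDeriv (j : Fin n) (ℓ : ℕ) (f : UnitAddTorus (Fin n) → ℂ) :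
    torusPartial j (toroidalDeriv j ℓ f) = fun x => 2 * Real.pi * Complex.I *
      (toroidalDeriv j (ℓ + 1) f x + ℓ * toroidalDeriv j ℓ f x) := by
  funext x
  have h : (2 * Real.pi * Complex.I : ℂ) ≠ 0 := Complex.two_pi_I_ne_zero
  simp only [toroidalDeriv]
  rw [sub_add_cancel, mul_inv_cancel_left₀ h]

theorem IsSymbolS.boundedPartials (h : IsSymbolS Λ ρ 0 σ) (j : Fin n) (N : ℕ) :
    BoundedPartials j N σ := by
  have hb : ∀ ℓ, BoundedSmooth fun k => toroidalDeriv j ℓ (σ k) := fun ℓ =>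
    ⟨fun k => (h.smooth k).toroidalDeriv j ℓ, h.norm_toroidalDeriv_le j ℓ⟩
  -- All `ℓ` are treated together, because one more partial derivative raises `ℓ`.
  have key : ∀ N ℓ, BoundedPartials j N fun k => toroidalDeriv j ℓ (σ k) := fun N => by
    induction N with
    | zero => exact hb
    | succ N ih =>
      intro ℓ
      refine ⟨hb ℓ, ?_⟩
      simp only [torusPartial_toroidalDeriv]
      exact ((ih (ℓ + 1)).add ((ih ℓ).const_mul ℓ)).const_mul _
  exact key N 0

theorem norm_le_latticeNorm (k : Fin n → ℤ) : ‖k‖ ≤ latticeNorm k := by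
  refine (pi_norm_le_iff_of_nonneg (Real.sqrt_nonneg _)).mpr fun j => ?_
  refine Real.le_sqrt_of_sq_le ?_
  rw [Int.norm_eq_abs, sq_abs]
  exact Finset.single_le_sum (f := fun j => (k j : ℝ) ^ 2) (fun i _ => sq_nonneg _)
    (Finset.mem_univ j)

theorem tendsto_latticeNorm : Tendsto (latticeNorm (n := n)) cofinite atTop := by
  refine tendsto_atTop_mono norm_le_latticeNorm ?_
  rw [← cocompact_eq_cofinite]
  exact tendsto_norm_cocompact_atTop

theorem IsWeightFunction.tendsto_atTop (h : IsWeightFunction Λ μ) : Tendsto Λ cofinite atTop := by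
  obtain ⟨μ₀, μ₁, C₀, C₁, hμ₀, -, -, hC₀, -, h⟩ := h.growth
  refine tendsto_atTop_mono (fun k => (h k).1) (Tendsto.const_mul_atTop hC₀ ?_)
  exact (tendsto_rpow_atTop hμ₀).comp (tendsto_atTop_add_const_left _ 1 tendsto_latticeNorm)

theorem IsSymbolS.vanishingOscillation (h : IsSymbolS Λ ρ 0 σ) (hΛ : IsWeightFunction Λ μ)
    (hρ : 0 < ρ) : VanishingOscillation σ := by
  refine vanishingOscillation_of_single fun j ε hε => ?_
  obtain ⟨C, -, hC⟩ := h.bound (Pi.single j 1) 0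
  have hlim := (((tendsto_rpow_neg_atTop hρ).comp hΛ.tendsto_atTop).const_mul C)
  rw [mul_zero] at hlim
  filter_upwards [hlim.eventually (Iic_mem_nhds hε)] with k hk x
  have h1 := hC k x
  rw [latticeDiff_single, toroidalDerivMulti_zero] at h1
  have h2 : multiOrder (Pi.single j 1 : Fin n → ℕ) = 1 := by simp [multiOrder]
  rw [h2, Nat.cast_one, mul_one, zero_sub] at h1
  exact h1.trans hk

theorem isMElliptic_zero_iff : IsMElliptic Λ 0 σ ↔
    ∃ C R : ℝ, 0 < C ∧ 0 < R ∧ ∀ k, R ≤ latticeNorm k → ∀ x, C ≤ ‖σ k x‖ := by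
  simp only [IsMElliptic, Real.rpow_zero, mul_one]

theorem isFredholm_of_isMElliptic (hΛ : IsWeightFunction Λ μ) (hρ : 0 < ρ)
    (h : IsSymbolS Λ ρ 0 σ) (hσ : HasSummableFourier σ) (he : IsMElliptic Λ 0 σ) :
    (shiftSeries hσ.coeff).IsFredholm := by
  classical
  obtain ⟨C, R, hC, -, hCR⟩ := isMElliptic_zero_iff.mp he
  -- Replacing `σ` by `1` on the ball where ellipticity says nothing makes `min C 1` a global lower
  -- bound, while changing only finitely many `k`.
  let σ' : (Fin n → ℤ) → UnitAddTorus (Fin n) → ℂ :=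
    fun k => if R ≤ latticeNorm k then σ k else fun _ => 1
  have hev : ∀ᶠ k in cofinite, σ k = σ' k := by
    filter_upwards [tendsto_latticeNorm.eventually_ge_atTop R] with k hk
    exact (if_pos hk).symm
  have hlow : ∀ k x, min C 1 ≤ ‖σ' k x‖ := fun k x => by
    by_cases hk : R ≤ latticeNorm k
    · simpa only [σ', if_pos hk] using (min_le_left _ _).trans (hCR k hk x)
    · simp [σ', if_neg hk]
  have hmin : 0 < min C 1 := lt_min hC one_pos
  have hpart : ∀ j N, BoundedPartials j N fun k x => (σ' k x)⁻¹ := fun j N =>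
    ((h.boundedPartials j N).ite (.const 1 N) _).inv hmin hlow
  have hσ'b : BoundedSmooth σ' := h.boundedSmooth.ite (.const 1) _
  have hb : BoundedSmooth fun k x => (σ' k x)⁻¹ :=
    ⟨fun k => (hσ'b.1 k).inv fun x => norm_pos_iff.mp (hmin.trans_le (hlow k x)),
      (min C 1)⁻¹, fun k x => by
        rw [norm_inv]
        exact inv_anti₀ hmin (hlow k x)⟩
  have hosc := h.vanishingOscillation hΛ hρ
  refine isFredholm_of_mul_eq_one hσ (hasSummableFourier_of_boundedPartials hb hpart) hosc
    ((hosc.congr hev).inv hmin hlow) ?_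
  filter_upwards [hev] with k hk x
  rw [hk]
  exact inv_mul_cancel₀ (norm_pos_iff.mp (hmin.trans_le (hlow k x)))

theorem isMElliptic_of_isFredholm (hΛ : IsWeightFunction Λ μ) (hρ : 0 < ρ)
    (h : IsSymbolS Λ ρ 0 σ) (hσ : HasSummableFourier σ)
    (hF : (shiftSeries hσ.coeff).IsFredholm) : IsMElliptic Λ 0 σ := by
  rw [isMElliptic_zero_iff]
  by_contra! hne
  have hpos : ∀ i : ℕ, (0 : ℝ) < i + 1 := fun i => by positivity
  -- Failure of ellipticity with constant `1 / (i + 1)` and radius `i + 1` gives points escaping to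
  -- infinity along which the symbol tends to zero.
  choose p hp x hx using fun i : ℕ => hne (1 / (i + 1)) (i + 1) (by positivity) (hpos i)
  refine not_tendsto_zero_of_isFredholm hσ (h.vanishingOscillation hΛ hρ) hF (p := p) ?_ x ?_
  · refine le_cofinite_iff_eventually_ne.mpr fun k => ?_
    obtain ⟨M, hM⟩ := exists_nat_ge (latticeNorm k)
    rw [eventually_map]
    filter_upwards [eventually_ge_atTop M] with i hi hik
    have h1 := hp i
    have h2 : (M : ℝ) ≤ i := by exact_mod_cast hi
    rw [hik] at h1
    linarith
  · exact squeeze_zero_norm (fun i => (hx i).le) tendsto_one_div_add_atTop_nhds_zero_nat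

end SymbolClass

theorem mainTheorem3 (n : ℕ) (Λ : (Fin n → ℤ) → ℝ) (μ : ℝ) (hΛ : IsWeightFunction Λ μ)
    (ρ : ℝ) (hρ_pos : 0 < ρ) (hρ_le : ρ ≤ 1 / μ)
    (σ : (Fin n → ℤ) → UnitAddTorus (Fin n) → ℂ) (hσ : IsSymbolM Λ ρ 0 σ) :
    ∃ T : EllTwo n →L[ℂ] EllTwo n,
      (∀ (f : EllTwo n) (k : Fin n → ℤ), T f k = latticePDO σ f k) ∧
      (T.IsFredholm ↔ IsMElliptic Λ 0 σ) := by
  have hS := hσ.isSymbolS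
  have hF := hasSummableFourier_of_boundedPartials hS.boundedSmooth hS.boundedPartials
  exact ⟨shiftSeries hF.coeff, hF.shiftSeries_apply_eq_latticePDO,
    isMElliptic_of_isFredholm hΛ hρ_pos hS hF, isFredholm_of_isMElliptic hΛ hρ_pos hS hF⟩
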